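/- A Lebesgue measurable set $\Omega\subset\mathbb{R}^d$ is called thick if there is $R>0$ such that $\inf_{a\in\mathbb{R}^d}|\Omega\cap(a+[-R,R]^d)|>0$, where $|\cdot|$ is Lebesgue measure. For $s\in\mathbb{R}$, $(-\Delta+1)^{s/2}$ denotes the Fourier multiplier with symbol $(|\xi|^2+1)^{s/2}$ (in the normalization in which $-\Delta$ has symbol $|\xi|^2$), acting on tempered distributions. **Proposition.** Let $s\ge 1$ and let $\Omega\subset\mathbb{R}^d$ be thick. Then there exist constants $C,c>0$ such that for all $f\in L^2(\mathbb{R}^d)$ and all $\lambda\ge 0$, $$c\,e^{-C\lambda}\,\|f\|_{L^2(\mathbb{R}^d)}^2\;\le\;\bigl\|\bigl((-\Delta+1)^{s/2}-\lambda\bigr)f\bigr\|_{L^2(\mathbb{R}^d)}^2+\|f\|_{L^2(\Omega)}^2,$$ where the first term on the right is understood to be $+\infty$ if $((-\Delta+1)^{s/2}-\lambda)f\notin L^2(\mathbb{R}^d)$. -/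

import Mathlib

open MeasureTheory
open scoped SchwartzMap ENNReal

/-- A subset `Ω` of `ℝ^d` is thick if there is `R > 0` such that the Lebesgue measure of `Ω` in
the cubes `a + [-R, R]^d`, `a ∈ ℝ^d`, is bounded below by a positive constant `γ`
(Lebesgue measurability of `Ω` is part of the notion). -/
def IsThick {d : ℕ} (Ω : Set (EuclideanSpace ℝ (Fin d))) : Prop :=
  NullMeasurableSet Ω volume ∧
    ∃ R : ℝ, 0 < R ∧ ∃ γ : ℝ, 0 < γ ∧ ∀ a : EuclideanSpace ℝ (Fin d),
      ENNReal.ofReal γ ≤ volume (Ω ∩ {x | ∀ i, |x i - a i| ≤ R})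

/-- The symbol of `(-Δ + 1)^(s/2)`. Mathlib's Fourier transform has the kernel
`exp (-2πi ⟨x, ξ⟩)`, so `-Δ` has the symbol `(2π)^2 |ξ|^2 = |2π ξ|^2`. -/
noncomputable def fracSymbol (d : ℕ) (s : ℝ) (ξ : EuclideanSpace ℝ (Fin d)) : ℂ :=
  (((1 + ‖(2 * Real.pi) • ξ‖ ^ 2) ^ (s / 2) : ℝ) : ℂ)

/-- The symbol has temperate growth, so that the Fourier multiplier below takes no junk value. -/
theorem hasTemperateGrowth_fracSymbol (d : ℕ) (s : ℝ) :
    (fracSymbol d s).HasTemperateGrowth := by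
  have h1 := Function.hasTemperateGrowth_one_add_norm_sq_rpow
    (EuclideanSpace ℝ (Fin d)) (s / 2)
  have h2 := ((2 * Real.pi) •
    ContinuousLinearMap.id ℝ (EuclideanSpace ℝ (Fin d))).hasTemperateGrowth
  exact Function.HasTemperateGrowth.comp Function.Complex.hasTemperateGrowth_ofReal (h1.comp h2)

/-- The operator `(-Δ + 1)^(s/2)` on tempered distributions on `ℝ^d`. -/
noncomputable def fracLaplacian (d : ℕ) (s : ℝ) :
    𝓢'(EuclideanSpace ℝ (Fin d), ℂ) →L[ℂ] 𝓢'(EuclideanSpace ℝ (Fin d), ℂ) :=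
  TemperedDistribution.fourierMultiplierCLM ℂ (fracSymbol d s)

/-- The `L^2(ℝ^d)` norm of a tempered distribution `u`: the norm of the (unique) `L^2` function
that represents `u` if there is one, and `∞` (the infimum over the empty set) if `u` is
not in `L^2`. -/
noncomputable def l2Norm {d : ℕ} (u : 𝓢'(EuclideanSpace ℝ (Fin d), ℂ)) : ℝ≥0∞ :=
  ⨅ (g : Lp ℂ 2 (volume : Measure (EuclideanSpace ℝ (Fin d))))
    (_ : (g : 𝓢'(EuclideanSpace ℝ (Fin d), ℂ)) = u), eLpNorm g 2 volume

/-!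
Let `σ` be the symbol of `(-Δ + 1)^(s/2)`. Split `f = w + (f - w)`, where `w` is the part of `f` at
the frequencies with `σ ≤ λ + 1`. On the remaining frequencies `σ - λ ≥ 1`, so Plancherel's theorem
gives `‖f - w‖ ≤ ‖((-Δ + 1)^(s/2) - λ) f‖` (`exists_band_limited_approximation`). As `s ≥ 1`, the
frequencies of `w` lie in the ball `|2πξ| ≤ λ + 1`, and the claim follows once
`‖w‖^2 ≤ exp (B (Λ + 1)) ‖w‖^2_{L^2(Ω)}` is known for every `L^2` function `w` with frequencies in
`|2πξ| ≤ Λ`. This is the Logvinenko-Sereda inequality `IsThick.lintegral_fourierInv_le`.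

It is proved by real-variable interpolation. On an interval `I`, let `E ⊆ I` have measure at
least `δ`. By Chebyshev's inequality, a smooth function `u` is at most about its mean square over
`E` at `n + 1` points of `E` whose gaps are at least `δ / (2(n + 1))`. Lagrange interpolation of
the Taylor polynomial of order `n` at these points costs only a factor `A ^ n`, with `A` depending
on `|I|` and `δ` alone, so that
`∫_I |u|^2 ≤ A ^ (n + 1) (∫_E |u|^2 + (1 / n!)^2 ∫_I |u^(n+1)|^2)` (`integral_sq_le_of_volume_le`).
An inequality of this shape on all coordinate lines passes to cubes in `ℝ^d`, one coordinate at a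
time, with only the pure derivatives in the error term (`lintegral_pi_le_of_forall_line`), and
from cubes to the whole space by averaging over all translates of a cube
(`exists_lintegral_sq_le_of_forall_closedBall`). For a band-limited function, Plancherel's theorem
bounds the `(n + 1)`-st derivatives by `Λ ^ (n + 1)`; when `n` is a large multiple of `Λ + 1` the
factor `1 / n!` beats `A ^ (n + 1) Λ ^ (2(n + 1))` (`exists_order_of_frequency`), the error term is
absorbed in the left-hand side, and the remaining constant `2 A ^ (n + 1)` is exponential in `Λ`.
-/

/-! ### Interpolation of polynomials at separated nodes -/

theorem prod_erase_abs_sub_eq_factorial_mul (n i : ℕ) (hi : i ≤ n) :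
    ∏ j ∈ (Finset.range (n + 1)).erase i, |(i : ℝ) - j| = (i.factorial * (n - i).factorial : ℕ) := by
  induction n, hi using Nat.le_induction with
  | base =>
    have h1 : (Finset.range (i + 1)).erase i = Finset.range i := by
      ext j; simp only [Finset.mem_erase, Finset.mem_range]; omega
    rw [h1, ← Finset.prod_range_reflect, ← Finset.prod_range_add_one_eq_factorial]
    simp only [Nat.sub_self, Nat.factorial_zero, mul_one, Nat.cast_prod]
    refine Finset.prod_congr rfl fun j hj => ?_
    have hj := Finset.mem_range.1 hj
    have : ((i - 1 - j : ℕ) : ℝ) = i - 1 - j := by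
      rw [Nat.cast_sub (by omega), Nat.cast_sub (by omega)]; simp
    rw [this]
    push_cast
    rw [abs_of_nonneg] <;> linarith [(Nat.cast_nonneg j : (0 : ℝ) ≤ j)]
  | succ n hn ih =>
    have h1 : (Finset.range (n + 1 + 1)).erase i
        = insert (n + 1) ((Finset.range (n + 1)).erase i) := by
      ext j; simp only [Finset.mem_erase, Finset.mem_range, Finset.mem_insert]; omega
    rw [h1, Finset.prod_insert (by simp), ih, Nat.succ_sub hn, Nat.factorial_succ]
    have : (i : ℝ) ≤ n := by exact_mod_cast hn
    have h2 : |(i : ℝ) - ((n + 1 : ℕ) : ℝ)| = ((n - i + 1 : ℕ) : ℝ) := by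
      rw [abs_sub_comm]
      push_cast [Nat.cast_sub hn]
      rw [abs_of_nonneg] <;> linarith
    rw [h2]
    push_cast
    ring

/-- If a polynomial of degree at most `n` is bounded by `m` at `n + 1` nodes of an interval of
length `L`, where the `i`-th and the `j`-th node are at least `h * |i - j|` apart, then it is
bounded by `(2 * L / h) ^ n / n! * m` on the whole interval. -/
theorem norm_eval_le_of_separated_nodes {n : ℕ} {P : Polynomial ℂ} (hP : P.degree < (n + 1 : ℕ))
    {a L h m : ℝ} (hh : 0 < h) {x : ℕ → ℝ}
    (hx : ∀ i ≤ n, x i ∈ Set.Icc a (a + L))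
    (hsep : ∀ i ≤ n, ∀ j ≤ n, h * |(i : ℝ) - j| ≤ |x i - x j|)
    (hm : ∀ i ≤ n, ‖P.eval (x i : ℂ)‖ ≤ m) {t : ℝ} (ht : t ∈ Set.Icc a (a + L)) :
    ‖P.eval (t : ℂ)‖ ≤ (2 * L / h) ^ n / n.factorial * m := by
  have hL : 0 ≤ L := by linarith [ht.1, ht.2]
  have hm0 : 0 ≤ m := (norm_nonneg _).trans (hm 0 (Nat.zero_le n))
  have hmem : ∀ i ∈ Finset.range (n + 1), i ≤ n := fun i hi => by
    have := Finset.mem_range.1 hi; omega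
  have hinj : Set.InjOn (fun i => (x i : ℂ)) (Finset.range (n + 1) : Set ℕ) := by
    intro i hi j hj hij
    by_contra hne
    have h1 := hsep i (hmem i hi) j (hmem j hj)
    have h2 : x i = x j := Complex.ofReal_injective hij
    have h3 : 0 < |(i : ℝ) - j| := abs_pos.2 (sub_ne_zero.2 (by exact_mod_cast hne))
    rw [h2, sub_self, abs_zero] at h1
    nlinarith [mul_pos hh h3]
  have hPe := Lagrange.eq_interpolate hinj (f := P) (by simpa using hP)
  rw [hPe, Lagrange.interpolate_apply, Polynomial.eval_finsetSum]
  have hbasis : ∀ i ∈ Finset.range (n + 1),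
      ‖(Lagrange.basis (Finset.range (n + 1)) (fun i => (x i : ℂ)) i).eval (t : ℂ)‖
        ≤ (L / h) ^ n / n.factorial * n.choose i := by
    intro i hi
    have hin := hmem i hi
    have hfac : ∀ j ∈ (Finset.range (n + 1)).erase i,
        ‖(Lagrange.basisDivisor (x i : ℂ) (x j : ℂ)).eval (t : ℂ)‖
          ≤ (L / h) * |(i : ℝ) - j|⁻¹ := by
      intro j hj
      have hjn := hmem j (Finset.mem_of_mem_erase hj)
      have hne : i ≠ j := (Finset.ne_of_mem_erase hj).symm
      have h3 : 0 < |(i : ℝ) - j| := abs_pos.2 (sub_ne_zero.2 (by exact_mod_cast hne))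
      have h4 : |t - x j| ≤ L := by
        have := hx j hjn
        rw [abs_le]; constructor <;> linarith [ht.1, ht.2, this.1, this.2]
      have h5 : ‖(Lagrange.basisDivisor (x i : ℂ) (x j : ℂ)).eval (t : ℂ)‖
          = |x i - x j|⁻¹ * |t - x j| := by
        simp only [Lagrange.basisDivisor, Polynomial.eval_mul, Polynomial.eval_C,
          Polynomial.eval_sub, Polynomial.eval_X, norm_mul, norm_inv]
        rw [← Complex.ofReal_sub, ← Complex.ofReal_sub, Complex.norm_real, Complex.norm_real,
          Real.norm_eq_abs, Real.norm_eq_abs]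
      rw [h5]
      calc |x i - x j|⁻¹ * |t - x j| ≤ (h * |(i : ℝ) - j|)⁻¹ * L := by
            gcongr
            exact hsep i hin j hjn
        _ = _ := by rw [mul_inv]; ring
    rw [Lagrange.basis, Polynomial.eval_prod, norm_prod]
    refine (Finset.prod_le_prod (fun _ _ => norm_nonneg _) hfac).trans (le_of_eq ?_)
    rw [Finset.prod_mul_distrib, Finset.prod_const, Finset.card_erase_of_mem hi,
      Finset.card_range, Finset.prod_inv_distrib, prod_erase_abs_sub_eq_factorial_mul n i hin,
      Nat.cast_choose ℝ hin, Nat.add_sub_cancel]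
    have := Nat.factorial_ne_zero n
    push_cast
    field_simp
  calc ‖∑ i ∈ Finset.range (n + 1), (Polynomial.C (P.eval (x i : ℂ)) *
        Lagrange.basis (Finset.range (n + 1)) (fun i => (x i : ℂ)) i).eval (t : ℂ)‖
      ≤ ∑ i ∈ Finset.range (n + 1), m * ((L / h) ^ n / n.factorial * n.choose i) := by
        refine norm_sum_le_of_le _ fun i hi => ?_
        rw [Polynomial.eval_mul, Polynomial.eval_C, norm_mul]
        exact mul_le_mul (hm i (hmem i hi)) (hbasis i hi) (norm_nonneg _) hm0
    _ = (2 * L / h) ^ n / n.factorial * m := by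
        rw [← Finset.mul_sum, ← Finset.mul_sum, ← Nat.cast_sum, Nat.sum_range_choose]
        push_cast
        rw [mul_div_assoc, mul_pow]
        ring

/-! ### Taylor polynomials with an integral bound for the remainder -/

/-- The Taylor polynomial at `a` of order `n` of a function whose `k`-th derivative is `u k`. -/
noncomputable def taylorPoly (u : ℕ → ℝ → ℂ) (a : ℝ) (n : ℕ) : Polynomial ℂ :=
  ∑ k ∈ Finset.range (n + 1),
    Polynomial.C (u k a / k.factorial) * (Polynomial.X - Polynomial.C (a : ℂ)) ^ k

theorem eval_taylorPoly (u : ℕ → ℝ → ℂ) (a : ℝ) (n : ℕ) (x : ℂ) :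
    (taylorPoly u a n).eval x =
      ∑ k ∈ Finset.range (n + 1), u k a / k.factorial * (x - a) ^ k := by
  simp [taylorPoly, Polynomial.eval_finsetSum]

theorem degree_taylorPoly_lt (u : ℕ → ℝ → ℂ) (a : ℝ) (n : ℕ) :
    (taylorPoly u a n).degree < (n + 1 : ℕ) := by
  rw [taylorPoly]
  refine (Polynomial.degree_sum_le _ _).trans_lt ?_
  rw [Finset.sup_lt_iff (by exact WithBot.bot_lt_coe (n + 1))]
  intro k hk
  refine ((Polynomial.degree_mul_le _ _).trans
    (add_le_add_left Polynomial.degree_C_le _)).trans_lt ?_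
  rw [Polynomial.degree_pow, Polynomial.degree_X_sub_C]
  have := Finset.mem_range.1 hk
  simp only [nsmul_eq_mul, mul_one, zero_add]
  exact_mod_cast this

theorem hasDerivAt_eval_taylorPoly_succ (u : ℕ → ℝ → ℂ) (a : ℝ) (n : ℕ) (x : ℝ) :
    HasDerivAt (fun y : ℝ => (taylorPoly u a (n + 1)).eval (y : ℂ))
      ((taylorPoly (fun k => u (k + 1)) a n).eval (x : ℂ)) x := by
  have h := ((taylorPoly u a (n + 1)).hasDerivAt (x : ℂ)).comp_ofReal
  convert h using 1
  rw [eval_taylorPoly, taylorPoly, Polynomial.derivative_sum, Polynomial.eval_finsetSum,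
    Finset.sum_range_succ' _ (n + 1)]
  simp only [Polynomial.derivative_mul, Polynomial.derivative_C, zero_mul, zero_add,
    Polynomial.derivative_X_sub_C_pow, pow_zero, Polynomial.derivative_one, mul_zero,
    Polynomial.eval_zero, add_zero, Nat.add_sub_cancel, Polynomial.eval_mul, Polynomial.eval_C,
    Polynomial.eval_pow, Polynomial.eval_sub, Polynomial.eval_X]
  refine Finset.sum_congr rfl fun k _ => ?_
  rw [Nat.factorial_succ]
  have h1 : ((k : ℂ) + 1) ≠ 0 := by exact_mod_cast Nat.succ_ne_zero k
  have h2 := Nat.factorial_ne_zero k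
  push_cast
  field_simp

/-- The remainder of the Taylor polynomial of order `n` is bounded through the integral of the
derivative of order `n + 1`, which is the quantity that Plancherel's theorem controls. -/
theorem norm_sub_taylorPoly_le {u : ℕ → ℝ → ℂ} (hu : ∀ k t, HasDerivAt (u k) (u (k + 1) t) t)
    {a b : ℝ} (n : ℕ) {x : ℝ} (hx : x ∈ Set.Icc a b) :
    ‖u 0 x - (taylorPoly u a n).eval (x : ℂ)‖
      ≤ (x - a) ^ n / n.factorial * ∫ t in a..b, ‖u (n + 1) t‖ := by
  have hc : ∀ k, Continuous (u k) := fun k =>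
    continuous_iff_continuousAt.2 fun t => (hu k t).continuousAt
  induction n generalizing u x with
  | zero =>
    have h1 : (taylorPoly u a 0).eval (x : ℂ) = u 0 a := by simp [eval_taylorPoly]
    rw [h1, ← intervalIntegral.integral_eq_sub_of_hasDerivAt (fun t _ => hu 0 t)
      ((hc 1).intervalIntegrable _ _)]
    simp only [zero_add, pow_zero, Nat.factorial_zero, Nat.cast_one, div_one, one_mul]
    refine (intervalIntegral.norm_integral_le_integral_norm hx.1).trans ?_
    exact intervalIntegral.integral_mono_interval le_rfl hx.1 hx.2
      (Filter.Eventually.of_forall fun _ => norm_nonneg _) ((hc 1).norm.intervalIntegrable _ _)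
  | succ n ih =>
    set J := ∫ t in a..b, ‖u (n + 1 + 1) t‖
    have hd : ∀ y : ℝ, HasDerivAt (fun y : ℝ => u 0 y - (taylorPoly u a (n + 1)).eval (y : ℂ))
        (u 1 y - (taylorPoly (fun k => u (k + 1)) a n).eval (y : ℂ)) y := fun y =>
      (hu 0 y).sub (hasDerivAt_eval_taylorPoly_succ u a n y)
    have hB : ∀ y : ℝ, HasDerivAt (fun y : ℝ => (y - a) ^ (n + 1) / (n + 1).factorial * J)
        ((y - a) ^ n / n.factorial * J) y := by
      intro y
      have h := (((hasDerivAt_id y).sub_const a).pow (n + 1)).div_const ((n + 1).factorial : ℝ)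
      refine (h.mul_const J).congr_deriv ?_
      have h2 := Nat.factorial_ne_zero n
      simp only [id, Nat.add_sub_cancel, mul_one]
      rw [Nat.factorial_succ]
      push_cast
      field_simp
    refine image_norm_le_of_norm_deriv_right_le_deriv_boundary'
      (f := fun y : ℝ => u 0 y - (taylorPoly u a (n + 1)).eval (y : ℂ))
      (B := fun y : ℝ => (y - a) ^ (n + 1) / (n + 1).factorial * J)
      (fun y _ => (hd y).continuousAt.continuousWithinAt) (fun y _ => (hd y).hasDerivWithinAt)
      ?_ (fun y _ => (hB y).continuousAt.continuousWithinAt)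
      (fun y _ => (hB y).hasDerivWithinAt) (fun y hy => ?_) hx
    · have h1 : (taylorPoly u a (n + 1)).eval (a : ℂ) = u 0 a := by
        rw [eval_taylorPoly, Finset.sum_range_succ']
        simp
      simp [h1]
    · exact ih (fun k t => hu (k + 1) t) ⟨hy.1, hy.2.le⟩ (fun k => hc (k + 1))

/-! ### Separated points in a set of positive measure -/

/-- A set of real numbers of measure greater than `n * h` contains `n + 1` points with consecutive
gaps at least `h`. -/
theorem exists_separated_points (n : ℕ) {h : ℝ} {E : Set ℝ} (hb : BddBelow E)
    (hE : ENNReal.ofReal (n * h) < volume E) (hh : 0 < h) :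
    ∃ x : ℕ → ℝ, (∀ i ≤ n, x i ∈ E) ∧ ∀ i < n, x i + h ≤ x (i + 1) := by
  induction n generalizing E with
  | zero =>
    obtain ⟨y, hy⟩ : E.Nonempty := by
      rw [Set.nonempty_iff_ne_empty]
      rintro rfl
      simp at hE
    exact ⟨fun _ => y, fun _ _ => hy, by simp⟩
  | succ n ih =>
    have hne : E.Nonempty := by
      rw [Set.nonempty_iff_ne_empty]
      rintro rfl
      simp at hE
    -- The first point is chosen within `ε` of `inf E`, and `ε` is small enough for the part of
    -- `E` beyond it to have measure greater than `n * h`.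
    obtain ⟨ε, hε, hεE⟩ : ∃ ε : ℝ, 0 < ε ∧ ENNReal.ofReal ((n + 1 : ℕ) * h + ε) < volume E := by
      obtain ⟨r, hr, hrE⟩ := ENNReal.lt_iff_exists_nnreal_btwn.1 hE
      have hr' : ((n + 1 : ℕ) : ℝ) * h < r := by
        have := (ENNReal.ofReal_lt_iff_lt_toReal (by positivity) ENNReal.coe_ne_top).1 hr
        simpa using this
      refine ⟨r - (n + 1 : ℕ) * h, by linarith, ?_⟩
      rw [add_sub_cancel, ENNReal.ofReal_coe_nnreal]
      exact hrE
    obtain ⟨y, hy, hylt⟩ := Real.lt_sInf_add_pos hne hε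
    have hcov : E ⊆ Set.Icc (sInf E) (y + h) ∪ E ∩ Set.Ici (y + h) := by
      intro z hz
      rcases le_total z (y + h) with hz' | hz'
      · exact Or.inl ⟨csInf_le hb hz, hz'⟩
      · exact Or.inr ⟨hz, hz'⟩
    have hvol : volume E ≤ ENNReal.ofReal (h + ε) + volume (E ∩ Set.Ici (y + h)) := by
      refine (measure_mono hcov).trans ((measure_union_le _ _).trans ?_)
      gcongr
      rw [Real.volume_Icc]
      exact ENNReal.ofReal_le_ofReal (by linarith)
    have hE' : ENNReal.ofReal (n * h) < volume (E ∩ Set.Ici (y + h)) := by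
      have h1 : ENNReal.ofReal ((n + 1 : ℕ) * h + ε)
          = ENNReal.ofReal (h + ε) + ENNReal.ofReal (n * h) := by
        rw [← ENNReal.ofReal_add (by positivity) (by positivity)]
        congr 1
        push_cast
        ring
      rw [h1] at hεE
      exact lt_of_add_lt_add_left (hεE.trans_le hvol)
    obtain ⟨x, hx, hxs⟩ := ih (hb.mono Set.inter_subset_left) hE'
    refine ⟨fun i => Nat.casesOn i y x, fun i hi => ?_, fun i hi => ?_⟩
    · cases i with
      | zero => exact hy
      | succ i => exact (hx i (by omega)).1
    · cases i with
      | zero => exact (hx 0 (Nat.zero_le n)).2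
      | succ i => exact hxs i (by omega)

theorem mul_abs_sub_le_of_add_le_succ {n : ℕ} {h : ℝ} {x : ℕ → ℝ}
    (hx : ∀ i < n, x i + h ≤ x (i + 1)) {i j : ℕ} (hi : i ≤ n) (hj : j ≤ n) :
    h * |(i : ℝ) - j| ≤ |x i - x j| := by
  have key : ∀ i j : ℕ, i ≤ j → j ≤ n → h * ((j : ℝ) - i) ≤ x j - x i := by
    intro i j hij
    induction j, hij using Nat.le_induction with
    | base => simp
    | succ j hij ih =>
      intro hj
      have h1 := ih (by omega)
      have h2 := hx j (by omega)
      push_cast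
      linarith
  rcases le_total i j with hij | hij
  · rw [abs_sub_comm, abs_sub_comm (x i), abs_of_nonneg (sub_nonneg.2 (by exact_mod_cast hij))]
    exact (key i j hij hj).trans (le_abs_self _)
  · rw [abs_of_nonneg (sub_nonneg.2 (by exact_mod_cast hij))]
    exact (key j i hij hi).trans (le_abs_self _)

/-! ### A quantitative unique continuation inequality on an interval -/

theorem sq_integral_le_mul_integral_sq {g : ℝ → ℝ} (hg : Continuous g) {a L : ℝ} (hL : 0 < L) :
    (∫ t in a..(a + L), g t) ^ 2 ≤ L * ∫ t in a..(a + L), g t ^ 2 := by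
  set c := (∫ t in a..(a + L), g t) / L
  have h0 : 0 ≤ ∫ t in a..(a + L), (g t - c) ^ 2 :=
    intervalIntegral.integral_nonneg (by linarith) fun t _ => sq_nonneg _
  have h1 : ∫ t in a..(a + L), (g t - c) ^ 2
      = (∫ t in a..(a + L), g t ^ 2) - 2 * c * (∫ t in a..(a + L), g t) + L * c ^ 2 := by
    have : ∀ t, (g t - c) ^ 2 = g t ^ 2 - 2 * c * g t + c ^ 2 := fun t => by ring
    simp_rw [this]
    rw [intervalIntegral.integral_add, intervalIntegral.integral_sub,
      intervalIntegral.integral_const_mul, intervalIntegral.integral_const]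
    · simp
    all_goals exact Continuous.intervalIntegrable (by fun_prop) _ _
  have h2 : (∫ t in a..(a + L), g t) = c * L := by simp [c, hL.ne']
  rw [h1, h2] at h0
  rw [h2]
  nlinarith

/-- A form of Chebyshev's inequality: a function does not exceed twice its average
on at least half of a set. -/
theorem half_le_volume_setOf_le_two_mul_average {g : ℝ → ℝ} (hg : Continuous g)
    (hg0 : ∀ t, 0 ≤ g t) {E : Set ℝ} (hgE : IntegrableOn g E) {δ : ℝ}
    (hδ : 0 < δ) (hEδ : ENNReal.ofReal δ ≤ volume E) :
    ENNReal.ofReal (δ / 2) ≤ volume {t ∈ E | g t ≤ 2 / δ * ∫ x in E, g x} := by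
  set w := ∫ x in E, g x with hw
  have hw0 : 0 ≤ w := integral_nonneg hg0
  have hbad : volume {t ∈ E | 2 / δ * w < g t} ≤ ENNReal.ofReal (δ / 2) := by
    have hmeas : MeasurableSet {t | 2 / δ * w < g t} := measurableSet_lt measurable_const
      hg.measurable
    have hset : volume {t ∈ E | 2 / δ * w < g t} = volume.restrict E {t | 2 / δ * w < g t} := by
      rw [Measure.restrict_apply hmeas, Set.inter_comm]
      rfl
    rw [hset]
    -- If the mean is zero, Markov's inequality is void, but then `g` vanishes almost everywhere.
    rcases hw0.eq_or_lt with h0 | hpos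
    · have h1 : g =ᵐ[volume.restrict E] 0 :=
        (integral_eq_zero_iff_of_nonneg hg0 hgE).1 h0.symm
      have h2 : volume.restrict E {t | 2 / δ * w < g t} = 0 := by
        rw [← h0, mul_zero]
        refine measure_mono_null (fun t ht => ?_) (ae_iff.1 h1)
        exact (ne_of_gt ht)
      rw [h2]
      exact zero_le
    · have h1 := mul_meas_ge_le_lintegral₀ (μ := volume.restrict E)
        (f := fun t => ENNReal.ofReal (g t)) (by fun_prop) (ENNReal.ofReal (2 / δ * w))
      rw [← ofReal_integral_eq_lintegral_ofReal hgE (Filter.Eventually.of_forall hg0)] at h1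
      have hq : 0 < 2 / δ * w := by positivity
      have h2 : volume.restrict E {t | 2 / δ * w < g t}
          ≤ volume.restrict E {t | ENNReal.ofReal (2 / δ * w) ≤ ENNReal.ofReal (g t)} :=
        measure_mono fun t ht => ENNReal.ofReal_le_ofReal (le_of_lt ht)
      refine h2.trans ?_
      have h3 : ENNReal.ofReal (δ / 2) = ENNReal.ofReal w / ENNReal.ofReal (2 / δ * w) := by
        rw [← ENNReal.ofReal_div_of_pos hq]
        congr 1
        field_simp
      rw [h3, ENNReal.le_div_iff_mul_le (Or.inl (by simpa using hq))
        (Or.inl ENNReal.ofReal_ne_top), mul_comm]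
      exact h1
  have hcov : E ⊆ {t ∈ E | g t ≤ 2 / δ * w} ∪ {t ∈ E | 2 / δ * w < g t} := fun t ht =>
    (le_or_gt (g t) (2 / δ * w)).imp (fun h => ⟨ht, h⟩) (fun h => ⟨ht, h⟩)
  have h1 := hEδ.trans ((measure_mono hcov).trans ((measure_union_le _ _).trans
    (add_le_add_right hbad _)))
  have h2 : ENNReal.ofReal δ = ENNReal.ofReal (δ / 2) + ENNReal.ofReal (δ / 2) := by
    rw [← ENNReal.ofReal_add (by positivity) (by positivity), add_halves]
  rw [h2] at h1
  exact (ENNReal.add_le_add_iff_right ENNReal.ofReal_ne_top).1 h1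

/-- The interpolation constant, which contains a power `(n + 1) ^ n / n!`, grows only
exponentially in `n`. -/
theorem pow_div_factorial_add_one_le {B : ℝ} (hB : 0 ≤ B) (n : ℕ) :
    (B * (n + 1)) ^ n / n.factorial + 1 ≤ (2 * Real.exp 1 * (1 + B)) ^ (n + 1) := by
  have h1 : (B * (n + 1)) ^ n / n.factorial ≤ (Real.exp 1 * (1 + B)) ^ (n + 1) := by
    have h2 := Real.pow_div_factorial_le_exp ((n : ℝ) + 1) (by positivity) n
    have h3 : Real.exp ((n : ℝ) + 1) = Real.exp 1 ^ (n + 1) := by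
      rw [← Real.exp_nat_mul, mul_one]
      push_cast
      rfl
    have h4 : B ^ n ≤ (1 + B) ^ (n + 1) := calc
      B ^ n ≤ (1 + B) ^ n := by gcongr; linarith
      _ ≤ (1 + B) ^ (n + 1) := pow_le_pow_right₀ (by linarith) (Nat.le_succ n)
    rw [mul_pow, mul_pow, mul_div_assoc, mul_comm, ← h3]
    gcongr
  have h3 : 1 ≤ (Real.exp 1 * (1 + B)) ^ (n + 1) := by
    refine one_le_pow₀ ?_
    have := Real.one_le_exp (zero_le_one' ℝ)
    nlinarith
  have h4 : (2 : ℝ) ≤ 2 ^ (n + 1) := le_self_pow₀ (by norm_num) (Nat.succ_ne_zero n)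
  rw [mul_assoc, mul_pow 2]
  nlinarith

theorem mul_add_mul_pow_le {B L w W : ℝ} (hB : 0 ≤ B) (n : ℕ) (hw : 0 ≤ w) (hW : 0 ≤ W) :
    B * w + 2 * L ^ (2 * n + 2) * W
      ≤ ((1 + B) * (1 + 2 * L ^ 2)) ^ (n + 1) * (w + W) := by
  have hL2 : 0 ≤ 2 * L ^ 2 := by positivity
  have h1 : 1 + B ≤ (1 + B) ^ (n + 1) := le_self_pow₀ (by linarith) (Nat.succ_ne_zero n)
  have h2 : 1 ≤ (1 + 2 * L ^ 2) ^ (n + 1) := one_le_pow₀ (by linarith)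
  have h3 : 2 * L ^ (2 * n + 2) ≤ (1 + 2 * L ^ 2) ^ (n + 1) := calc
    2 * L ^ (2 * n + 2) = 2 * (L ^ 2) ^ (n + 1) := by rw [← pow_mul, mul_add, mul_one]
    _ ≤ 2 ^ (n + 1) * (L ^ 2) ^ (n + 1) := by
        gcongr
        exact le_self_pow₀ (by norm_num) (Nat.succ_ne_zero n)
    _ = (2 * L ^ 2) ^ (n + 1) := (mul_pow _ _ _).symm
    _ ≤ _ := by gcongr; linarith
  rw [mul_pow, mul_add]
  refine add_le_add (mul_le_mul_of_nonneg_right ?_ hw) (mul_le_mul_of_nonneg_right ?_ hW)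
  · nlinarith
  · nlinarith

/-- On an interval `I` of length `L`, a smooth function is controlled by its
values on a subset `E` of measure at least `δ` and by its derivative of order `n + 1`: interpolate
the Taylor polynomial of order `n` at `n + 1` separated points of `E`. -/
theorem integral_sq_le_of_volume_le {L δ : ℝ} (hL : 0 < L) (hδ : 0 < δ) :
    ∃ A : ℝ, 1 ≤ A ∧ ∀ (a : ℝ) (n : ℕ) (u : ℕ → ℝ → ℂ),
      (∀ k t, HasDerivAt (u k) (u (k + 1) t) t) → ∀ E : Set ℝ,
      E ⊆ Set.Icc a (a + L) → ENNReal.ofReal δ ≤ volume E →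
      ∫ t in Set.Icc a (a + L), ‖u 0 t‖ ^ 2 ≤ A ^ (n + 1) * ((∫ t in E, ‖u 0 t‖ ^ 2) +
        1 / (n.factorial : ℝ) ^ 2 * ∫ t in Set.Icc a (a + L), ‖u (n + 1) t‖ ^ 2) := by
  set B : ℝ := 4 * L / δ with hB
  have hB0 : 0 < B := by positivity
  set D : ℝ := 2 * Real.exp 1 * (1 + B)
  have hA1 : 1 ≤ D ^ 2 * (1 + B) * (1 + 2 * L ^ 2) := by
    have h1 : 1 ≤ D := by
      have := Real.one_le_exp (zero_le_one' ℝ)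
      have h2 : 1 ≤ 2 * Real.exp 1 := by linarith
      nlinarith
    have h2 : 1 ≤ D ^ 2 := one_le_pow₀ h1
    have h3 : 1 ≤ D ^ 2 * (1 + B) := by nlinarith
    nlinarith [sq_nonneg L]
  refine ⟨D ^ 2 * (1 + B) * (1 + 2 * L ^ 2), hA1, fun a n u hu E hEI hEδ => ?_⟩
  have hc : ∀ k, Continuous (u k) := fun k =>
    continuous_iff_continuousAt.2 fun t => (hu k t).continuousAt
  have hc2 : ∀ k, Continuous fun t => ‖u k t‖ ^ 2 := fun k => (hc k).norm.pow 2
  have hI : ∀ k, IntegrableOn (fun t => ‖u k t‖ ^ 2) (Set.Icc a (a + L)) := fun k =>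
    (hc2 k).continuousOn.integrableOn_Icc
  set w := ∫ t in E, ‖u 0 t‖ ^ 2
  set V := ∫ t in Set.Icc a (a + L), ‖u (n + 1) t‖ ^ 2 with hV
  have hw0 : 0 ≤ w := integral_nonneg fun t => by positivity
  have hV0 : 0 ≤ V := integral_nonneg fun t => by positivity
  set h : ℝ := δ / (2 * (n + 1)) with hh
  have hh0 : 0 < h := by positivity
  -- `n + 1` points of `E` at which the function is not much larger than its mean over `E`.
  have hvol := half_le_volume_setOf_le_two_mul_average (hc2 0) (fun t => by positivity)
    ((hI 0).mono_set hEI) hδ hEδ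
  obtain ⟨x, hxE, hxs⟩ := exists_separated_points n (h := h)
    (bddBelow_Icc.mono ((Set.sep_subset _ _).trans hEI))
    (lt_of_lt_of_le ((ENNReal.ofReal_lt_ofReal_iff (by positivity)).2
      (by rw [hh, mul_div_assoc', div_lt_div_iff₀ (by positivity) (by positivity)]; nlinarith)) hvol)
    hh0
  set m := Real.sqrt (2 / δ * w)
  set r := L ^ n / n.factorial * ∫ t in a..(a + L), ‖u (n + 1) t‖ with hr
  set Λ := (2 * L / h) ^ n / n.factorial with hΛ
  have hJ0 : 0 ≤ ∫ t in a..(a + L), ‖u (n + 1) t‖ :=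
    intervalIntegral.integral_nonneg (by linarith) fun t _ => norm_nonneg _
  have hr0 : 0 ≤ r := by positivity
  have hΛ0 : 0 ≤ Λ := by positivity
  have hTaylor : ∀ t ∈ Set.Icc a (a + L), ‖u 0 t - (taylorPoly u a n).eval (t : ℂ)‖ ≤ r := by
    intro t ht
    refine (norm_sub_taylorPoly_le hu n ht).trans ?_
    rw [hr]
    have h1 : 0 ≤ t - a := by linarith [ht.1]
    have h2 : t - a ≤ L := by linarith [ht.2]
    gcongr
  have hpt : ∀ t ∈ Set.Icc a (a + L), ‖u 0 t‖ ^ 2 ≤ 2 * (Λ + 1) ^ 2 * (2 / δ * w + r ^ 2) := by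
    intro t ht
    have h1 : ‖(taylorPoly u a n).eval (t : ℂ)‖ ≤ Λ * (m + r) := by
      refine norm_eval_le_of_separated_nodes (degree_taylorPoly_lt u a n) hh0
        (fun i hi => hEI (hxE i hi).1)
        (fun i hi j hj => mul_abs_sub_le_of_add_le_succ hxs hi hj) (fun i hi => ?_) ht
      have h2 := hTaylor (x i) (hEI (hxE i hi).1)
      have h3 : ‖u 0 (x i)‖ ≤ m := Real.le_sqrt_of_sq_le (hxE i hi).2
      have h4 := norm_sub_norm_le ((taylorPoly u a n).eval (x i : ℂ)) (u 0 (x i))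
      rw [norm_sub_rev] at h4
      linarith
    have h2 := norm_sub_norm_le (u 0 t) ((taylorPoly u a n).eval (t : ℂ))
    have h3 := hTaylor t ht
    have hm0 : 0 ≤ m := Real.sqrt_nonneg _
    have h4 : ‖u 0 t‖ ≤ (Λ + 1) * (m + r) := by nlinarith
    have h5 : m ^ 2 = 2 / δ * w := Real.sq_sqrt (by positivity)
    rw [← h5]
    calc ‖u 0 t‖ ^ 2 ≤ ((Λ + 1) * (m + r)) ^ 2 := by gcongr
      _ = (Λ + 1) ^ 2 * (m + r) ^ 2 := by ring
      _ ≤ (Λ + 1) ^ 2 * (2 * (m ^ 2 + r ^ 2)) := by gcongr; nlinarith [sq_nonneg (m - r)]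
      _ = _ := by ring
  have hint : ∫ t in Set.Icc a (a + L), ‖u 0 t‖ ^ 2
      ≤ L * (2 * (Λ + 1) ^ 2 * (2 / δ * w + r ^ 2)) := by
    refine (setIntegral_mono_on (hI 0) (integrableOn_const (by simp)) measurableSet_Icc
      hpt).trans (le_of_eq ?_)
    simp [hL.le]
  have hr2 : r ^ 2 ≤ L ^ (2 * n + 1) * (1 / (n.factorial : ℝ) ^ 2 * V) := by
    have h1 := sq_integral_le_mul_integral_sq (hc (n + 1)).norm (a := a) hL
    rw [intervalIntegral.integral_of_le (a := a) (b := a + L)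
      (f := fun t => ‖u (n + 1) t‖ ^ 2) (by linarith), ← integral_Icc_eq_integral_Ioc, ← hV] at h1
    calc r ^ 2 = (L ^ n / n.factorial) ^ 2 * (∫ t in a..(a + L), ‖u (n + 1) t‖) ^ 2 := by
          rw [hr, mul_pow]
      _ ≤ (L ^ n / n.factorial) ^ 2 * (L * V) := by gcongr
      _ = _ := by
        rw [div_pow]
        ring
  have hΛ1 : Λ + 1 ≤ D ^ (n + 1) := by
    refine le_of_eq_of_le ?_ (pow_div_factorial_add_one_le hB0.le n)
    rw [hΛ, hh, hB]
    congr 3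
    field_simp
    ring
  have hD2 : (Λ + 1) ^ 2 ≤ (D ^ 2) ^ (n + 1) := by
    rw [← pow_mul, mul_comm 2, pow_mul]
    gcongr
  have hW0 : 0 ≤ 1 / (n.factorial : ℝ) ^ 2 * V := by positivity
  calc ∫ t in Set.Icc a (a + L), ‖u 0 t‖ ^ 2
      ≤ L * (2 * (Λ + 1) ^ 2 * (2 / δ * w + r ^ 2)) := hint
    _ ≤ L * (2 * (D ^ 2) ^ (n + 1) *
          (2 / δ * w + L ^ (2 * n + 1) * (1 / (n.factorial : ℝ) ^ 2 * V))) := by gcongr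
    _ = (D ^ 2) ^ (n + 1) *
          (B * w + 2 * L ^ (2 * n + 2) * (1 / (n.factorial : ℝ) ^ 2 * V)) := by
        rw [hB]
        ring
    _ ≤ _ := by
        rw [mul_assoc (D ^ 2), mul_pow (D ^ 2), mul_assoc ((D ^ 2) ^ (n + 1))]
        exact mul_le_mul_of_nonneg_left (mul_add_mul_pow_le hB0.le n hw0 hW0) (by positivity)

theorem ofReal_setIntegral_norm_sq {v : ℝ → ℂ} (hv : Continuous v) {E : Set ℝ} {a b : ℝ}
    (hE : E ⊆ Set.Icc a b) :
    ENNReal.ofReal (∫ t in E, ‖v t‖ ^ 2) = ∫⁻ t in E, ‖v t‖ₑ ^ 2 := by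
  have hc : Continuous fun t => ‖v t‖ ^ 2 := hv.norm.pow 2
  rw [ofReal_integral_eq_lintegral_ofReal (hc.continuousOn.integrableOn_Icc.mono_set hE)
    (Filter.Eventually.of_forall fun t => by positivity)]
  simp_rw [ENNReal.ofReal_pow (norm_nonneg _), ofReal_norm]

/-- The inequality `integral_sq_le_of_volume_le` in terms of lower Lebesgue integrals. -/
theorem lintegral_sq_le_of_volume_le {L δ : ℝ} (hL : 0 < L) (hδ : 0 < δ) :
    ∃ A : ℝ, 1 ≤ A ∧ ∀ (a : ℝ) (n : ℕ) (u : ℕ → ℝ → ℂ),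
      (∀ k t, HasDerivAt (u k) (u (k + 1) t) t) → ∀ E : Set ℝ,
      E ⊆ Set.Icc a (a + L) → ENNReal.ofReal δ ≤ volume E →
      ∫⁻ t in Set.Icc a (a + L), ‖u 0 t‖ₑ ^ 2 ≤
        ENNReal.ofReal (A ^ (n + 1)) * ((∫⁻ t in E, ‖u 0 t‖ₑ ^ 2) +
          ∫⁻ t in Set.Icc a (a + L),
            ENNReal.ofReal (1 / (n.factorial : ℝ) ^ 2) * ‖u (n + 1) t‖ₑ ^ 2) := by
  obtain ⟨A, hA, h⟩ := integral_sq_le_of_volume_le hL hδ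
  refine ⟨A, hA, fun a n u hu E hEI hEδ => ?_⟩
  have hc : ∀ k, Continuous (u k) := fun k =>
    continuous_iff_continuousAt.2 fun t => (hu k t).continuousAt
  have h1 := ENNReal.ofReal_le_ofReal (h a n u hu E hEI hEδ)
  rw [ENNReal.ofReal_mul (by positivity), ENNReal.ofReal_add
    (integral_nonneg fun t => by positivity)
    (mul_nonneg (by positivity) (integral_nonneg fun t => by positivity)),
    ENNReal.ofReal_mul (by positivity), ofReal_setIntegral_norm_sq (hc 0) le_rfl,
    ofReal_setIntegral_norm_sq (hc 0) hEI, ofReal_setIntegral_norm_sq (hc (n + 1)) le_rfl] at h1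
  rwa [lintegral_const_mul' _ _ ENNReal.ofReal_ne_top]

/-! ### From one to several variables -/

theorem measurable_fin_cons {d : ℕ} :
    Measurable fun p : ℝ × (Fin d → ℝ) => (Fin.cons p.1 p.2 : Fin (d + 1) → ℝ) := by
  refine measurable_pi_iff.2 fun j => ?_
  refine Fin.cases ?_ (fun j => ?_) j
  · exact measurable_fst
  · exact (measurable_pi_apply j).comp measurable_snd

theorem lintegral_pi_succ {d : ℕ} (μ : Fin (d + 1) → Measure ℝ) [∀ i, SigmaFinite (μ i)]
    {F : (Fin (d + 1) → ℝ) → ℝ≥0∞} (hF : Measurable F) :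
    ∫⁻ x, F x ∂Measure.pi μ
      = ∫⁻ t, ∫⁻ y, F (Fin.cons t y) ∂Measure.pi (fun j : Fin d => μ j.succ) ∂μ 0 := by
  have h := (measurePreserving_piFinSuccAbove μ 0).symm
  have h1 : ∀ p : ℝ × (Fin d → ℝ), (MeasurableEquiv.piFinSuccAbove (fun _ => ℝ) 0).symm p
      = (Fin.cons p.1 p.2 : Fin (d + 1) → ℝ) := fun p =>
    Fin.insertNth_zero' p.1 p.2
  rw [← h.lintegral_comp hF]
  simp_rw [h1]
  exact lintegral_prod _ (hF.comp measurable_fin_cons).aemeasurable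

/-- An inequality that bounds the integral of `F` over every line in a coordinate direction by
its integral over any subset of the line that is not too small, up to error terms `G i`, passes
to product measures. The set `E` is treated one coordinate at a time: if it is large, then its
slice in the first coordinate is large for a large set `S` of the other coordinates. -/
theorem lintegral_pi_le_of_forall_line {m δ K : ℝ≥0∞} (hK : 1 ≤ K) (d : ℕ)
    (μ : Fin d → Measure ℝ) [∀ i, SigmaFinite (μ i)] (hμ : ∀ i, μ i Set.univ ≤ m)
    {F : (Fin d → ℝ) → ℝ≥0∞} (hF : Measurable F)
    {G : Fin d → (Fin d → ℝ) → ℝ≥0∞} (hG : ∀ i, Measurable (G i))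
    (h : ∀ i x (A : Set ℝ), MeasurableSet A → δ ≤ μ i A →
      ∫⁻ t, F (Function.update x i t) ∂μ i ≤ K * ((∫⁻ t in A, F (Function.update x i t) ∂μ i) +
        ∫⁻ t, G i (Function.update x i t) ∂μ i))
    {E : Set (Fin d → ℝ)} (hE : MeasurableSet E)
    (hEδ : d * δ * m ^ d < m * Measure.pi μ E) :
    ∫⁻ x, F x ∂Measure.pi μ ≤
      K ^ d * ((∫⁻ x in E, F x ∂Measure.pi μ) + ∑ i, ∫⁻ x, G i x ∂Measure.pi μ) := by
  induction d with
  | zero =>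
    have hne : E.Nonempty := by
      rw [Set.nonempty_iff_ne_empty]
      rintro rfl
      simp at hEδ
    have hu : E = Set.univ := Subsingleton.eq_univ_of_nonempty hne
    simp [hu]
  | succ d ih =>
    set ν := Measure.pi (fun j : Fin d => μ j.succ) with hν
    have hFc : Measurable fun p : ℝ × (Fin d → ℝ) => F (Fin.cons p.1 p.2) :=
      hF.comp measurable_fin_cons
    have hEc : MeasurableSet {p : ℝ × (Fin d → ℝ) | (Fin.cons p.1 p.2 : Fin (d + 1) → ℝ) ∈ E} :=
      measurable_fin_cons hE
    set slice : (Fin d → ℝ) → Set ℝ := fun y => {t | (Fin.cons t y : Fin (d + 1) → ℝ) ∈ E}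
    have hslice : ∀ y, MeasurableSet (slice y) := fun y =>
      hEc.preimage (measurable_id.prodMk measurable_const)
    have hslice' : Measurable fun y => μ 0 (slice y) := measurable_measure_prodMk_right hEc
    set S : Set (Fin d → ℝ) := {y | δ ≤ μ 0 (slice y)}
    have hS : MeasurableSet S := measurableSet_le measurable_const hslice'
    have hswap : ∀ {H : (Fin (d + 1) → ℝ) → ℝ≥0∞}, Measurable H →
        ∫⁻ x, H x ∂Measure.pi μ = ∫⁻ y, ∫⁻ t, H (Fin.cons t y) ∂μ 0 ∂ν := by
      intro H hH
      rw [lintegral_pi_succ μ hH, lintegral_lintegral_swap]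
      exact (hH.comp measurable_fin_cons).aemeasurable
    have hind : ∀ y t, E.indicator F (Fin.cons t y)
        = (slice y).indicator (fun t => F (Fin.cons t y)) t := fun y t => rfl
    have hEF : ∫⁻ x in E, F x ∂Measure.pi μ
        = ∫⁻ y, ∫⁻ t in slice y, F (Fin.cons t y) ∂μ 0 ∂ν := by
      rw [← lintegral_indicator hE, hswap (hF.indicator hE)]
      simp_rw [hind]
      exact lintegral_congr fun y => lintegral_indicator (hslice y) _
    have hEvol : Measure.pi μ E = ∫⁻ y, μ 0 (slice y) ∂ν := by
      rw [← lintegral_indicator_one hE, hswap (measurable_one.indicator hE)]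
      exact lintegral_congr fun y => lintegral_indicator_one (hslice y)
    -- The set of large slices is large.
    have hSδ : d * δ * m ^ d < m * ν S := by
      have h1 : ∀ y, μ 0 (slice y) ≤ S.indicator (fun _ => m) y + δ := by
        intro y
        by_cases hy : y ∈ S
        · rw [Set.indicator_of_mem hy]
          exact ((measure_mono (Set.subset_univ _)).trans (hμ 0)).trans le_self_add
        · rw [Set.indicator_of_notMem hy, zero_add]
          exact le_of_lt (not_le.1 hy)
      have h2 : ν Set.univ ≤ m ^ d := by
        rw [hν, Measure.pi_univ]
        exact (Finset.prod_le_prod' fun i _ => hμ i.succ).trans (by simp)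
      have h3 : Measure.pi μ E ≤ m * ν S + δ * m ^ d := by
        rw [hEvol]
        refine (lintegral_mono h1).trans ?_
        rw [lintegral_add_right _ measurable_const, lintegral_indicator_const hS, lintegral_const]
        gcongr
      have h4 : m * (d * δ * m ^ d) + δ * m ^ (d + 1) < m * (m * ν S) + δ * m ^ (d + 1) := by
        calc m * (d * δ * m ^ d) + δ * m ^ (d + 1) = ((d + 1 : ℕ) : ℝ≥0∞) * δ * m ^ (d + 1) := by
              push_cast
              ring
          _ < m * Measure.pi μ E := hEδ
          _ ≤ m * (m * ν S + δ * m ^ d) := by gcongr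
          _ = _ := by ring
      exact lt_of_mul_lt_mul_left' (lt_of_add_lt_add_right h4)
    have hline : ∀ t, ∫⁻ y, F (Fin.cons t y) ∂ν ≤ K ^ d * ((∫⁻ y in S, F (Fin.cons t y) ∂ν) +
        ∑ i : Fin d, ∫⁻ y, G i.succ (Fin.cons t y) ∂ν) := by
      intro t
      refine ih (fun j : Fin d => μ j.succ) (fun j => hμ j.succ)
        (F := fun y => F (Fin.cons t y)) (hFc.comp measurable_prodMk_left)
        (G := fun i y => G i.succ (Fin.cons t y))
        (fun i => ((hG i.succ).comp measurable_fin_cons).comp measurable_prodMk_left)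
        (fun i y A hA hAδ => ?_) hS hSδ
      have := h i.succ (Fin.cons t y) A hA hAδ
      simpa only [Fin.cons_update] using this
    have hfirst : ∫⁻ t, ∫⁻ y in S, F (Fin.cons t y) ∂ν ∂μ 0
        ≤ K * ((∫⁻ x in E, F x ∂Measure.pi μ) + ∫⁻ x, G 0 x ∂Measure.pi μ) := by
      rw [lintegral_lintegral_swap hFc.aemeasurable, hEF, hswap (hG 0)]
      have hm1 : Measurable fun y => ∫⁻ t, G 0 (Fin.cons t y) ∂μ 0 :=
        ((hG 0).comp measurable_fin_cons).lintegral_prod_left'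
      rw [← lintegral_add_right _ hm1]
      calc ∫⁻ y in S, ∫⁻ t, F (Fin.cons t y) ∂μ 0 ∂ν
          ≤ ∫⁻ y in S, K * ((∫⁻ t in slice y, F (Fin.cons t y) ∂μ 0) +
              ∫⁻ t, G 0 (Fin.cons t y) ∂μ 0) ∂ν := by
            refine setLIntegral_mono' hS fun y hy => ?_
            have := h 0 (Fin.cons 0 y) (slice y) (hslice y) hy
            simpa only [Fin.update_cons_zero] using this
        _ ≤ ∫⁻ y, K * ((∫⁻ t in slice y, F (Fin.cons t y) ∂μ 0) +
              ∫⁻ t, G 0 (Fin.cons t y) ∂μ 0) ∂ν := setLIntegral_le_lintegral _ _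
        _ = _ := by
            refine lintegral_const_mul _ (Measurable.add ?_ hm1)
            have h5 : Measurable fun y => ∫⁻ t, E.indicator F (Fin.cons t y) ∂μ 0 :=
              ((hF.indicator hE).comp measurable_fin_cons).lintegral_prod_left'
            convert h5 using 2 with y
            simp_rw [hind]
            exact (lintegral_indicator (hslice y) _).symm
    have hGs : ∀ i : Fin d, Measurable fun t => ∫⁻ y, G i.succ (Fin.cons t y) ∂ν := fun i =>
      ((hG i.succ).comp measurable_fin_cons).lintegral_prod_right'
    have hsum : ∫⁻ t, ∑ i : Fin d, ∫⁻ y, G i.succ (Fin.cons t y) ∂ν ∂μ 0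
        = ∑ i : Fin d, ∫⁻ x, G i.succ x ∂Measure.pi μ := by
      rw [lintegral_finsetSum _ fun i _ => hGs i]
      exact Finset.sum_congr rfl fun i _ => (lintegral_pi_succ μ (hG i.succ)).symm
    calc ∫⁻ x, F x ∂Measure.pi μ = ∫⁻ t, ∫⁻ y, F (Fin.cons t y) ∂ν ∂μ 0 := lintegral_pi_succ μ hF
      _ ≤ ∫⁻ t, K ^ d * ((∫⁻ y in S, F (Fin.cons t y) ∂ν) +
            ∑ i : Fin d, ∫⁻ y, G i.succ (Fin.cons t y) ∂ν) ∂μ 0 := lintegral_mono hline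
      _ = K ^ d * ((∫⁻ t, ∫⁻ y in S, F (Fin.cons t y) ∂ν ∂μ 0) +
            ∑ i : Fin d, ∫⁻ x, G i.succ x ∂Measure.pi μ) := by
          have hm2 : Measurable fun t => ∑ i : Fin d, ∫⁻ y, G i.succ (Fin.cons t y) ∂ν :=
            Finset.measurable_fun_sum _ fun i _ => hGs i
          have hm3 : Measurable fun t => ∫⁻ y in S, F (Fin.cons t y) ∂ν :=
            hFc.lintegral_prod_right'
          rw [lintegral_const_mul _ (hm3.fun_add hm2), lintegral_add_right _ hm2, hsum]
      _ ≤ K ^ d * (K * ((∫⁻ x in E, F x ∂Measure.pi μ) + ∫⁻ x, G 0 x ∂Measure.pi μ) +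
            K * ∑ i : Fin d, ∫⁻ x, G i.succ x ∂Measure.pi μ) := by
          gcongr
          exact le_mul_of_one_le_left' hK
      _ = _ := by
          rw [Fin.sum_univ_succ]
          ring

/-! ### Thick sets: averaging over all cubes of a fixed size -/

/-- Averaging over all translates of a cube recovers the integral over the whole space. The closed
balls of `Fin d → ℝ` are cubes, since the norm is the supremum norm. -/
theorem lintegral_setLIntegral_closedBall {d : ℕ} {R : ℝ} (hR : 0 ≤ R)
    {H : (Fin d → ℝ) → ℝ≥0∞} (hH : Measurable H) :
    ∫⁻ a : Fin d → ℝ, ∫⁻ x in Metric.closedBall a R, H x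
      = ENNReal.ofReal ((2 * R) ^ d) * ∫⁻ x, H x := by
  have h1 : ∀ a x : Fin d → ℝ, (Metric.closedBall a R).indicator H x
      = (Metric.closedBall x R).indicator (fun _ => H x) a := by
    intro a x
    by_cases h : x ∈ Metric.closedBall a R
    · rw [Set.indicator_of_mem h, Set.indicator_of_mem (Metric.mem_closedBall_comm.1 h)]
    · rw [Set.indicator_of_notMem h,
        Set.indicator_of_notMem fun h' => h (Metric.mem_closedBall_comm.1 h')]
  have hmeas : Measurable (Function.uncurry fun a x : Fin d → ℝ =>
      (Metric.closedBall a R).indicator H x) := by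
    have hs : MeasurableSet {p : (Fin d → ℝ) × (Fin d → ℝ) | dist p.2 p.1 ≤ R} :=
      measurableSet_le (measurable_snd.dist measurable_fst) measurable_const
    exact (hH.comp measurable_snd).indicator hs
  simp_rw [← lintegral_indicator measurableSet_closedBall]
  rw [lintegral_lintegral_swap hmeas.aemeasurable]
  simp_rw [h1, lintegral_indicator_const measurableSet_closedBall,
    Real.volume_pi_closedBall _ hR, Fintype.card_fin]
  rw [lintegral_mul_const _ hH, mul_comm]

/-- The inequality of `lintegral_sq_le_of_volume_le` on `ℝ^d`, for a set `E` that fills a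
proportion of every cube of side `2 * R`: on each cube it holds by
`lintegral_pi_le_of_forall_line`, and averaging over all cubes gives it on the whole space.
The function `u i k` is the `k`-th derivative of `F` in the `i`-th coordinate. -/
theorem exists_lintegral_sq_le_of_forall_closedBall (d : ℕ) {R γ : ℝ} (hR : 0 < R) (hγ : 0 < γ) :
    ∃ A : ℝ, 1 ≤ A ∧ ∀ E : Set (Fin d → ℝ), MeasurableSet E →
      (∀ a, ENNReal.ofReal γ ≤ volume (E ∩ Metric.closedBall a R)) →
      ∀ (n : ℕ) (F : (Fin d → ℝ) → ℂ) (u : Fin d → ℕ → (Fin d → ℝ) → ℂ),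
      Measurable F → (∀ i k, Measurable (u i k)) → (∀ i, u i 0 = F) →
      (∀ i k x t, HasDerivAt (fun s => u i k (Function.update x i s))
        (u i (k + 1) (Function.update x i t)) t) →
      ∫⁻ x, ‖F x‖ₑ ^ 2 ≤ ENNReal.ofReal (A ^ (n + 1)) * ((∫⁻ x in E, ‖F x‖ₑ ^ 2) +
        ENNReal.ofReal (1 / (n.factorial : ℝ) ^ 2) * ∑ i, ∫⁻ x, ‖u i (n + 1) x‖ₑ ^ 2) := by
  set L := 2 * R with hL
  have hL0 : 0 < L := by positivity
  set δ : ℝ := L * γ / ((d + 1) * L ^ d) with hδ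
  have hδ0 : 0 < δ := by positivity
  have hδL : d * δ * L ^ d < L * γ := by
    have h1 : d * δ * L ^ d = d * (L * γ) / (d + 1) := by
      rw [hδ]
      field_simp
    rw [h1, div_lt_iff₀ (by positivity)]
    nlinarith [mul_pos hL0 hγ]
  -- With this `δ`, a subset of measure `γ` of a cube meets the condition of
  -- `lintegral_pi_le_of_forall_line`.
  obtain ⟨A, hA, hline⟩ := lintegral_sq_le_of_volume_le hL0 hδ0
  refine ⟨A ^ d, one_le_pow₀ hA, fun E hE hEγ n F u hF hu hu0 hderiv => ?_⟩
  set K : ℝ≥0∞ := ENNReal.ofReal (A ^ (n + 1)) with hK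
  have hKd : ENNReal.ofReal ((A ^ d) ^ (n + 1)) = K ^ d := by
    rw [hK, ← ENNReal.ofReal_pow (by positivity), ← pow_mul, ← pow_mul, mul_comm]
  have hKtop : K ^ d ≠ ⊤ := ENNReal.pow_ne_top ENNReal.ofReal_ne_top
  set c := ENNReal.ofReal (1 / (n.factorial : ℝ) ^ 2)
  have hF2 : Measurable fun x => ‖F x‖ₑ ^ 2 := hF.enorm.pow_const 2
  have hG2 : ∀ i, Measurable fun x => c * ‖u i (n + 1) x‖ₑ ^ 2 := fun i =>
    ((hu i (n + 1)).enorm.pow_const 2).const_mul c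
  set H : (Fin d → ℝ) → ℝ≥0∞ := fun x =>
    E.indicator (fun x => ‖F x‖ₑ ^ 2) x + ∑ i, c * ‖u i (n + 1) x‖ₑ ^ 2 with hHdef
  have hHint : ∀ μ : Measure (Fin d → ℝ), ∫⁻ x, H x ∂μ
      = (∫⁻ x in E, ‖F x‖ₑ ^ 2 ∂μ) + ∑ i, ∫⁻ x, c * ‖u i (n + 1) x‖ₑ ^ 2 ∂μ := by
    intro μ
    rw [hHdef, lintegral_add_left (hF2.indicator hE), lintegral_indicator hE,
      lintegral_finsetSum _ fun i _ => hG2 i]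
  have hcube : ∀ a : Fin d → ℝ, ∫⁻ x in Metric.closedBall a R, ‖F x‖ₑ ^ 2
      ≤ K ^ d * ∫⁻ x in Metric.closedBall a R, H x := by
    intro a
    set μ : Fin d → Measure ℝ := fun i => volume.restrict (Set.Icc (a i - R) (a i - R + L))
    have hμ : volume.restrict (Metric.closedBall a R) = Measure.pi μ := by
      rw [closedBall_pi _ hR.le, volume_pi, Measure.restrict_pi_pi]
      congr 1
      funext i
      change _ = volume.restrict (Set.Icc (a i - R) (a i - R + L))
      rw [Real.closedBall_eq_Icc, show a i - R + L = a i + R by rw [hL]; ring]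
    rw [hHint, hμ]
    refine lintegral_pi_le_of_forall_line (m := ENNReal.ofReal L) (δ := ENNReal.ofReal δ)
      (ENNReal.one_le_ofReal.2 (one_le_pow₀ hA)) d μ (fun i => ?_) hF2 hG2
      (fun i x S hS hSδ => ?_) hE ?_
    · simp [μ]
    · rw [Measure.restrict_apply hS] at hSδ
      have h1 := hline (a i - R) n (fun k t => u i k (Function.update x i t))
        (fun k t => hderiv i k x t) (S ∩ Set.Icc (a i - R) (a i - R + L))
        Set.inter_subset_right hSδ
      simp only [hu0] at h1
      rwa [Measure.restrict_restrict hS]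
    · rw [← hμ, Measure.restrict_apply hE]
      refine lt_of_lt_of_le ?_ (mul_le_mul_right (hEγ a) _)
      rw [← ENNReal.ofReal_mul hL0.le, ← ENNReal.ofReal_pow hL0.le,
        ← ENNReal.ofReal_natCast, ← ENNReal.ofReal_mul (by positivity),
        ← ENNReal.ofReal_mul (by positivity)]
      exact (ENNReal.ofReal_lt_ofReal_iff (by positivity)).2 hδL
  have hH : Measurable H :=
    (hF2.indicator hE).add (Finset.measurable_fun_sum _ fun i _ => hG2 i)
  have hV0 : ENNReal.ofReal (L ^ d) ≠ 0 := by
    rw [Ne, ENNReal.ofReal_eq_zero, not_le]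
    positivity
  have havg : ENNReal.ofReal (L ^ d) * ∫⁻ x, ‖F x‖ₑ ^ 2
      ≤ ENNReal.ofReal (L ^ d) * (K ^ d * ∫⁻ x, H x) := by
    calc ENNReal.ofReal (L ^ d) * ∫⁻ x, ‖F x‖ₑ ^ 2
        = ∫⁻ a : Fin d → ℝ, ∫⁻ x in Metric.closedBall a R, ‖F x‖ₑ ^ 2 :=
          (lintegral_setLIntegral_closedBall hR.le hF2).symm
      _ ≤ ∫⁻ a : Fin d → ℝ, K ^ d * ∫⁻ x in Metric.closedBall a R, H x := lintegral_mono hcube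
      _ = ENNReal.ofReal (L ^ d) * (K ^ d * ∫⁻ x, H x) := by
          rw [lintegral_const_mul' _ _ hKtop, lintegral_setLIntegral_closedBall hR.le hH]
          ring
  have h1 := (ENNReal.mul_le_mul_iff_right hV0 ENNReal.ofReal_ne_top).1 havg
  rw [hHint] at h1
  rw [hKd, Finset.mul_sum]
  convert h1 using 4 with i
  exact (lintegral_const_mul' _ _ ENNReal.ofReal_ne_top).symm

/-! ### Band-limited functions -/

section BandLimited

open FourierTransform

variable {V : Type*} [NormedAddCommGroup V] [InnerProductSpace ℝ V] [FiniteDimensional ℝ V]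
  [MeasurableSpace V] [BorelSpace V]

theorem continuous_fourierInv_of_integrable {g : V → ℂ} (hg : Integrable g) :
    Continuous (𝓕⁻ g) :=
  VectorFourier.fourierIntegral_continuous Real.continuous_fourierChar
    (L := -innerₗ V) (continuous_inner (𝕜 := ℝ) (E := V)).neg hg

/-- The inverse Fourier transform on `L^2` is given by the Fourier integral
on `L^1 ∩ L^2`. -/
theorem fourierInv_toLp_ae_eq {g : V → ℂ} (hg : Integrable g) (hg2 : MemLp g 2) :
    ((𝓕⁻ (hg2.toLp g) : Lp ℂ 2 (volume : Measure V)) : V → ℂ) =ᵐ[volume] 𝓕⁻ g := by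
  refine ae_eq_of_integral_contDiff_smul_eq ((Lp.memLp _).locallyIntegrable (by norm_num))
    (continuous_fourierInv_of_integrable hg).locallyIntegrable fun φ hφ hφc => ?_
  have hc : HasCompactSupport (Complex.ofRealCLM ∘ φ) := hφc.comp_left rfl
  set Φ : 𝓢(V, ℂ) := hc.toSchwartzMap (by fun_prop)
  change ∫ x, Φ x • (𝓕⁻ (hg2.toLp g) : Lp ℂ 2 (volume : Measure V)) x = ∫ x, Φ x • (𝓕⁻ g) x
  have key := calc ∫ x, Φ x • (𝓕⁻ (hg2.toLp g) : Lp ℂ 2 (volume : Measure V)) x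
      = Lp.toTemperedDistribution (𝓕⁻ (hg2.toLp g) : Lp ℂ 2 (volume : Measure V)) Φ :=
        (Lp.toTemperedDistribution_apply _ _).symm
    _ = Lp.toTemperedDistribution (hg2.toLp g) (𝓕⁻ Φ) := by
        rw [← Lp.fourierInv_toTemperedDistribution_eq, TemperedDistribution.fourierInv_apply]
    _ = ∫ x, (𝓕⁻ Φ) x • g x := by
        rw [Lp.toTemperedDistribution_apply]
        refine integral_congr_ae ?_
        filter_upwards [hg2.coeFn_toLp] with x hx
        rw [hx]
    _ = ∫ x, Φ x • (𝓕⁻ g) x := by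
        have h := VectorFourier.integral_fourierIntegral_smul_eq_flip (L := -innerₗ V)
          (μ := volume) (ν := volume)
          Real.continuous_fourierChar (continuous_inner (𝕜 := ℝ) (E := V)).neg
          (Φ.integrable (μ := volume)) hg
        rw [SchwartzMap.fourierInv_coe]
        have hflip : (-innerₗ V).flip = -innerₗ V := by
          ext x y
          simp [real_inner_comm]
        rw [hflip] at h
        exact h
  exact key

/-- Plancherel's theorem for the Fourier integral of a function in `L^1 ∩ L^2`. -/
theorem eLpNorm_fourierInv_eq {g : V → ℂ} (hg : Integrable g) (hg2 : MemLp g 2) :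
    eLpNorm (𝓕⁻ g) 2 volume = eLpNorm g 2 volume := by
  rw [← eLpNorm_congr_ae (fourierInv_toLp_ae_eq hg hg2), ← eLpNorm_congr_ae hg2.coeFn_toLp,
    ← Lp.enorm_def, ← Lp.enorm_def, ← ofReal_norm, ← ofReal_norm]
  congr 1
  exact (Lp.fourierTransformₗᵢ V ℂ).symm.norm_map _

theorem hasDerivAt_fourierInv_comp {g : V → ℂ} (hg : Integrable g)
    (hg' : Integrable fun ξ => ‖ξ‖ * ‖g ξ‖) {c : ℝ → V} {e : V} {t : ℝ} (hc : HasDerivAt c e t) :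
    HasDerivAt (fun s => 𝓕⁻ g (c s))
      (𝓕⁻ (fun ξ => (2 * Real.pi * inner ℝ ξ e * Complex.I) * g ξ) (c t)) t := by
  have h := (VectorFourier.hasFDerivAt_fourierIntegral (-innerSL ℝ) hg hg' (c t)).comp_hasDerivAt
    t hc
  have hint : Integrable (VectorFourier.fourierSMulRight (-innerSL ℝ) g) := by
    refine ((hg'.const_mul (2 * Real.pi * ‖-innerSL ℝ (E := V)‖))).mono'
      hg.1.fourierSMulRight (Filter.Eventually.of_forall fun v => ?_)
    rw [← mul_assoc]
    exact VectorFourier.norm_fourierSMulRight_le _ _ _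
  rw [VectorFourier.fourierIntegral_continuousLinearMap_apply Real.continuous_fourierChar
    hint] at h
  have he : (fun ξ => (2 * Real.pi * inner ℝ ξ e * Complex.I) * g ξ)
      = fun ξ => VectorFourier.fourierSMulRight (-innerSL ℝ) g ξ e := by
    funext ξ
    rw [VectorFourier.fourierSMulRight_apply]
    have h1 : (-innerSL ℝ (E := V)) ξ e = -inner ℝ ξ e := rfl
    rw [h1, Complex.real_smul, smul_eq_mul]
    push_cast
    ring
  rw [he]
  exact h

theorem integrable_of_memLp_of_norm_le {g : V → ℂ} (hg : MemLp g 2) {r : ℝ}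
    (hr : ∀ ξ, g ξ ≠ 0 → ‖ξ‖ ≤ r) : Integrable g := by
  have hs : Function.support g ⊆ Metric.closedBall 0 r := fun ξ hξ => by
    simpa using hr ξ hξ
  have : IsFiniteMeasure (volume.restrict (Metric.closedBall (0 : V) r)) :=
    ⟨by simpa using measure_closedBall_lt_top⟩
  exact (integrableOn_iff_integrable_of_support_subset hs).1
    ((hg.restrict _).integrable (by norm_num))

omit [FiniteDimensional ℝ V] [MeasurableSpace V] [BorelSpace V] in
theorem norm_two_pi_inner_mul_I_pow_mul_le {g : V → ℂ} {r : ℝ}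
    (hr : ∀ ξ, g ξ ≠ 0 → ‖(2 * Real.pi) • ξ‖ ≤ r) {e : V} (he : ‖e‖ ≤ 1) (k : ℕ) (ξ : V) :
    ‖(2 * Real.pi * inner ℝ ξ e * Complex.I) ^ k * g ξ‖ ≤ r ^ k * ‖g ξ‖ := by
  by_cases h : g ξ = 0
  · simp [h]
  · rw [norm_mul, norm_pow]
    gcongr
    refine le_trans ?_ (hr ξ h)
    have h1 : ‖(2 * Real.pi * inner ℝ ξ e * Complex.I : ℂ)‖ = 2 * Real.pi * |inner ℝ ξ e| := by
      simp [abs_of_pos Real.pi_pos]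
    rw [h1, norm_smul, Real.norm_of_nonneg (by positivity)]
    gcongr
    exact (abs_real_inner_le_norm ξ e).trans (mul_le_of_le_one_right (norm_nonneg _) he)

end BandLimited

/-! ### The Logvinenko-Sereda inequality -/

/-- The choice of the order of the Taylor expansion: since `n!` grows faster than any power,
an order `n` proportional to the frequency bound `Λ` makes the remainder small. -/
theorem exists_order_of_frequency (d : ℕ) {A : ℝ} (hA : 1 ≤ A) :
    ∃ B : ℝ, 0 < B ∧ ∀ Λ : ℝ, 0 ≤ Λ → ∃ n : ℕ,
      A ^ (n + 1) * (1 / (n.factorial : ℝ) ^ 2 * (d * (Λ ^ (n + 1)) ^ 2)) ≤ 1 / 2 ∧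
      2 * A ^ (n + 1) ≤ Real.exp (B * (Λ + 1)) := by
  set M : ℝ := A * (2 * d + 1) with hM
  set e := Real.exp 1
  have he : 0 < e := Real.exp_pos 1
  have hM1 : 1 ≤ M := by
    have : (0 : ℝ) ≤ d := Nat.cast_nonneg d
    nlinarith
  refine ⟨((e + 1) * M + 2) * (1 + A), by positivity, fun Λ hΛ => ?_⟩
  set x := M * (Λ + 1) with hx
  have hx0 : 0 ≤ x := by positivity
  -- For `n ≥ (e + 1) x`, the exponential series gives
  -- `x ^ (n + 1) / n! ≤ exp (x + e x - n) ≤ 1`.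
  refine ⟨⌈(e + 1) * x⌉₊, ?_, ?_⟩
  · set n := ⌈(e + 1) * x⌉₊
    have hn : (e + 1) * x ≤ n := Nat.le_ceil _
    have hfac : (0 : ℝ) < n.factorial := by exact_mod_cast Nat.factorial_pos n
    have hxn : x ^ (n + 1) ≤ n.factorial := by
      have h1 : (e * x) ^ n ≤ Real.exp (e * x) * n.factorial :=
        (div_le_iff₀ hfac).1 (Real.pow_div_factorial_le_exp (e * x) (by positivity) n)
      have h2 : x ≤ Real.exp x := by linarith [Real.add_one_le_exp x]
      have h3 : e ^ n = Real.exp n := by rw [← Real.exp_nat_mul, mul_one]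
      have h4 : Real.exp x * Real.exp (e * x) ≤ e ^ n := by
        rw [h3, ← Real.exp_add]
        exact Real.exp_le_exp.2 (by linarith)
      rw [mul_pow] at h1
      have h5 : e ^ n * x ^ (n + 1) ≤ e ^ n * n.factorial := by
        calc e ^ n * x ^ (n + 1) = x * (e ^ n * x ^ n) := by ring
          _ ≤ Real.exp x * (Real.exp (e * x) * n.factorial) := by gcongr
          _ = (Real.exp x * Real.exp (e * x)) * n.factorial := by ring
          _ ≤ _ := by gcongr
      exact le_of_mul_le_mul_left h5 (by positivity)
    have hAd : 2 * A ^ (n + 1) * d ≤ (M ^ (n + 1)) ^ 2 := by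
      have h1 : (2 * d + 1 : ℝ) ≤ (2 * d + 1) ^ (n + 1) :=
        le_self_pow₀ (by linarith [(Nat.cast_nonneg d : (0 : ℝ) ≤ d)]) (Nat.succ_ne_zero n)
      have h2 : 0 ≤ A ^ (n + 1) := by positivity
      have h3 : 2 * A ^ (n + 1) * d ≤ M ^ (n + 1) := by
        rw [hM, mul_pow]
        nlinarith
      exact h3.trans (le_self_pow₀ (one_le_pow₀ hM1) two_ne_zero)
    have hΛx : (M ^ (n + 1)) ^ 2 * (Λ ^ (n + 1)) ^ 2 ≤ (n.factorial : ℝ) ^ 2 := by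
      rw [← mul_pow, ← mul_pow]
      refine pow_le_pow_left₀ (by positivity) (le_trans ?_ hxn) 2
      rw [hx]
      gcongr
      linarith
    have h1 : 2 * (A ^ (n + 1) * (d * (Λ ^ (n + 1)) ^ 2)) ≤ (n.factorial : ℝ) ^ 2 := by
      refine le_trans ?_ hΛx
      calc 2 * (A ^ (n + 1) * (d * (Λ ^ (n + 1)) ^ 2))
          = 2 * A ^ (n + 1) * d * (Λ ^ (n + 1)) ^ 2 := by ring
        _ ≤ _ := by gcongr
    have h2 : A ^ (n + 1) * (1 / (n.factorial : ℝ) ^ 2 * (d * (Λ ^ (n + 1)) ^ 2))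
        = A ^ (n + 1) * (d * (Λ ^ (n + 1)) ^ 2) / (n.factorial : ℝ) ^ 2 := by ring
    rw [h2, div_le_iff₀ (by positivity)]
    linarith
  · set n := ⌈(e + 1) * x⌉₊
    have hn : (n : ℝ) + 1 ≤ ((e + 1) * M + 2) * (Λ + 1) := by
      have h1 : (n : ℝ) < (e + 1) * x + 1 := Nat.ceil_lt_add_one (by positivity)
      have h2 : (e + 1) * x = (e + 1) * M * (Λ + 1) := by rw [hx]; ring
      nlinarith
    have hAe : A ≤ Real.exp A := by linarith [Real.add_one_le_exp A]
    have h2 : 2 ≤ e ^ (n + 1) := by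
      have : (2 : ℝ) ≤ e := by linarith [Real.add_one_le_exp (1 : ℝ)]
      exact this.trans (le_self_pow₀ (by linarith) (Nat.succ_ne_zero n))
    calc 2 * A ^ (n + 1) ≤ e ^ (n + 1) * Real.exp A ^ (n + 1) := by gcongr
      _ = Real.exp ((n + 1) * (1 + A)) := by
          rw [← mul_pow, ← Real.exp_add, ← Real.exp_nat_mul]
          push_cast
          rfl
      _ ≤ _ := Real.exp_le_exp.2 (by nlinarith)

theorem lintegral_enorm_sq_eq_eLpNorm_sq {α : Type*} [MeasurableSpace α] (f : α → ℂ)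
    (μ : Measure α) : ∫⁻ x, ‖f x‖ₑ ^ 2 ∂μ = eLpNorm f 2 μ ^ 2 := by
  have h := eLpNorm_nnreal_pow_eq_lintegral (f := f) (μ := μ) (p := 2) two_ne_zero
  simpa using h.symm

section Euclidean

open FourierTransform

variable {d : ℕ}

/-- The Fourier transform of the `k`-th derivative in the `i`-th coordinate of the function with
Fourier transform `g`. -/
noncomputable def coordDerivSymbol (g : EuclideanSpace ℝ (Fin d) → ℂ) (i : Fin d) (k : ℕ)
    (ξ : EuclideanSpace ℝ (Fin d)) : ℂ :=
  (2 * Real.pi * inner ℝ ξ (EuclideanSpace.single i (1 : ℝ)) * Complex.I) ^ k * g ξ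

theorem norm_coordDerivSymbol_le {g : EuclideanSpace ℝ (Fin d) → ℂ} {Λ : ℝ}
    (hΛ : ∀ ξ, g ξ ≠ 0 → ‖(2 * Real.pi) • ξ‖ ≤ Λ) (i : Fin d) (k : ℕ)
    (ξ : EuclideanSpace ℝ (Fin d)) : ‖coordDerivSymbol g i k ξ‖ ≤ Λ ^ k * ‖g ξ‖ :=
  norm_two_pi_inner_mul_I_pow_mul_le hΛ (by simp) k ξ

theorem memLp_coordDerivSymbol {g : EuclideanSpace ℝ (Fin d) → ℂ} (hg : MemLp g 2) {Λ : ℝ}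
    (hΛ : ∀ ξ, g ξ ≠ 0 → ‖(2 * Real.pi) • ξ‖ ≤ Λ) (i : Fin d) (k : ℕ) :
    MemLp (coordDerivSymbol g i k) 2 := by
  refine hg.of_le_mul (c := Λ ^ k) ?_ (Filter.Eventually.of_forall
    (norm_coordDerivSymbol_le hΛ i k))
  refine AEStronglyMeasurable.mul (Continuous.aestronglyMeasurable ?_) hg.1
  fun_prop

theorem integrable_and_integrable_norm_mul_of_memLp {g : EuclideanSpace ℝ (Fin d) → ℂ} (hg : MemLp g 2) {Λ : ℝ}
    (hΛ : ∀ ξ, g ξ ≠ 0 → ‖(2 * Real.pi) • ξ‖ ≤ Λ) :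
    Integrable g ∧ Integrable fun ξ => ‖ξ‖ * ‖g ξ‖ := by
  have hr : ∀ ξ, g ξ ≠ 0 → ‖ξ‖ ≤ Λ / (2 * Real.pi) := by
    intro ξ hξ
    have h1 := hΛ ξ hξ
    rw [norm_smul, Real.norm_of_nonneg (by positivity)] at h1
    rw [le_div_iff₀ (by positivity)]
    linarith
  have hgi := integrable_of_memLp_of_norm_le hg hr
  refine ⟨hgi, (hgi.norm.const_mul (Λ / (2 * Real.pi))).mono' ?_ ?_⟩
  · exact continuous_norm.aestronglyMeasurable.mul hg.1.norm
  · refine Filter.Eventually.of_forall fun ξ => ?_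
    rw [Real.norm_of_nonneg (by positivity)]
    by_cases h : g ξ = 0
    · simp [h]
    · exact mul_le_mul_of_nonneg_right (hr ξ h) (norm_nonneg _)

theorem hasDerivAt_fourierInv_coordDerivSymbol {g : EuclideanSpace ℝ (Fin d) → ℂ}
    (hg : MemLp g 2) {Λ : ℝ} (hΛ : ∀ ξ, g ξ ≠ 0 → ‖(2 * Real.pi) • ξ‖ ≤ Λ) (i : Fin d) (k : ℕ)
    (x : Fin d → ℝ) (t : ℝ) :
    HasDerivAt (fun s => 𝓕⁻ (coordDerivSymbol g i k) (WithLp.toLp 2 (Function.update x i s)))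
      (𝓕⁻ (coordDerivSymbol g i (k + 1)) (WithLp.toLp 2 (Function.update x i t))) t := by
  have hk := memLp_coordDerivSymbol hg hΛ i k
  have hsupp : ∀ ξ, coordDerivSymbol g i k ξ ≠ 0 → ‖(2 * Real.pi) • ξ‖ ≤ Λ := fun ξ hξ =>
    hΛ ξ (right_ne_zero_of_mul hξ)
  have hint := integrable_and_integrable_norm_mul_of_memLp hk hsupp
  have hc : HasDerivAt (fun s => (WithLp.toLp 2 (Function.update x i s) :
      EuclideanSpace ℝ (Fin d))) (EuclideanSpace.single i (1 : ℝ)) t :=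
    ((PiLp.continuousLinearEquiv 2 ℝ fun _ : Fin d => ℝ).symm.hasFDerivAt).comp_hasDerivAt t
      (hasDerivAt_update x i t)
  have h := hasDerivAt_fourierInv_comp hint.1 hint.2 hc
  have hsucc : coordDerivSymbol g i (k + 1) = fun ξ =>
      (2 * Real.pi * inner ℝ ξ (EuclideanSpace.single i (1 : ℝ)) * Complex.I) *
        coordDerivSymbol g i k ξ := by
    funext ξ
    rw [coordDerivSymbol, coordDerivSymbol, pow_succ']
    ring
  rw [hsucc]
  exact h

/-- By Plancherel, a coordinate derivative of order `k` costs at most a factor `Λ ^ k`. -/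
theorem lintegral_fourierInv_coordDerivSymbol_le {g : EuclideanSpace ℝ (Fin d) → ℂ}
    (hg : MemLp g 2) {Λ : ℝ} (hΛ0 : 0 ≤ Λ)
    (hΛ : ∀ ξ, g ξ ≠ 0 → ‖(2 * Real.pi) • ξ‖ ≤ Λ) (i : Fin d) (k : ℕ) :
    ∫⁻ x, ‖𝓕⁻ (coordDerivSymbol g i k) x‖ₑ ^ 2
      ≤ ENNReal.ofReal ((Λ ^ k) ^ 2) * ∫⁻ x, ‖𝓕⁻ g x‖ₑ ^ 2 := by
  have hk := memLp_coordDerivSymbol hg hΛ i k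
  have hsupp : ∀ ξ, coordDerivSymbol g i k ξ ≠ 0 → ‖(2 * Real.pi) • ξ‖ ≤ Λ := fun ξ hξ =>
    hΛ ξ (right_ne_zero_of_mul hξ)
  rw [lintegral_enorm_sq_eq_eLpNorm_sq, lintegral_enorm_sq_eq_eLpNorm_sq,
    eLpNorm_fourierInv_eq (integrable_and_integrable_norm_mul_of_memLp hk hsupp).1 hk,
    eLpNorm_fourierInv_eq (integrable_and_integrable_norm_mul_of_memLp hg hΛ).1 hg,
    ENNReal.ofReal_pow (by positivity), ← mul_pow]
  gcongr
  exact eLpNorm_le_mul_eLpNorm_of_ae_le_mul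
    (Filter.Eventually.of_forall (norm_coordDerivSymbol_le hΛ i k)) 2

/-- The **Logvinenko-Sereda inequality** with a constant that is exponential in the frequency
bound `Λ`. -/
theorem IsThick.lintegral_fourierInv_le {Ω : Set (EuclideanSpace ℝ (Fin d))} (hΩ : IsThick Ω) :
    ∃ B : ℝ, 0 < B ∧ ∀ Λ : ℝ, 0 ≤ Λ → ∀ g : EuclideanSpace ℝ (Fin d) → ℂ, MemLp g 2 →
      (∀ ξ, g ξ ≠ 0 → ‖(2 * Real.pi) • ξ‖ ≤ Λ) →
      ∫⁻ x, ‖𝓕⁻ g x‖ₑ ^ 2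
        ≤ ENNReal.ofReal (Real.exp (B * (Λ + 1))) * ∫⁻ x in Ω, ‖𝓕⁻ g x‖ₑ ^ 2 := by
  obtain ⟨hΩm, R, hR, γ, hγ, hΩγ⟩ := hΩ
  obtain ⟨Ω', hΩ'sub, hΩ'm, hΩ'ae⟩ := hΩm.exists_measurable_subset_ae_eq
  -- The one-coordinate-at-a-time inequality lives on `Fin d → ℝ`, where Lebesgue measure is a
  -- product measure.
  have hmp := PiLp.volume_preserving_toLp (Fin d)
  have hemb := (MeasurableEquiv.toLp 2 (Fin d → ℝ)).measurableEmbedding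
  set E : Set (Fin d → ℝ) := WithLp.toLp 2 ⁻¹' Ω'
  have hE : MeasurableSet E := hmp.measurable hΩ'm
  have hEγ : ∀ a, ENNReal.ofReal γ ≤ volume (E ∩ Metric.closedBall a R) := by
    intro a
    refine (hΩγ (WithLp.toLp 2 a)).trans (le_of_eq ?_)
    have h1 : E ∩ Metric.closedBall a R
        = WithLp.toLp 2 ⁻¹' (Ω' ∩ {x | ∀ i, |x i - (WithLp.toLp 2 a :
          EuclideanSpace ℝ (Fin d)) i| ≤ R}) := by
      rw [Set.preimage_inter]
      congr 1
      ext y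
      simp [dist_pi_le_iff hR.le, Real.dist_eq]
    rw [h1, hmp.measure_preimage_emb hemb]
    exact measure_congr (hΩ'ae.symm.inter (ae_eq_refl _))
  have hpull : ∀ H : EuclideanSpace ℝ (Fin d) → ℝ≥0∞,
      ∫⁻ y : Fin d → ℝ, H (WithLp.toLp 2 y) = ∫⁻ x, H x := fun H =>
    hmp.lintegral_comp_emb hemb H
  have hpullE : ∀ H : EuclideanSpace ℝ (Fin d) → ℝ≥0∞,
      ∫⁻ y in E, H (WithLp.toLp 2 y) = ∫⁻ x in Ω', H x := fun H =>
    (hmp.restrict_preimage_emb hemb Ω').lintegral_comp_emb hemb H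
  obtain ⟨A, hA, hmain⟩ := exists_lintegral_sq_le_of_forall_closedBall d hR hγ
  obtain ⟨B, hB, horder⟩ := exists_order_of_frequency d hA
  refine ⟨B, hB, fun Λ hΛ0 g hg hΛ => ?_⟩
  obtain ⟨n, hn, hnB⟩ := horder Λ hΛ0
  have hcont : ∀ i k, Continuous (𝓕⁻ (coordDerivSymbol g i k)) := fun i k =>
    continuous_fourierInv_of_integrable (integrable_and_integrable_norm_mul_of_memLp
      (memLp_coordDerivSymbol hg hΛ i k) fun ξ hξ => hΛ ξ (right_ne_zero_of_mul hξ)).1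
  have hgi := (integrable_and_integrable_norm_mul_of_memLp hg hΛ).1
  have hzero : ∀ i, coordDerivSymbol g i 0 = g := fun i => by
    funext ξ
    simp [coordDerivSymbol]
  have h := hmain E hE hEγ n (fun y => 𝓕⁻ g (WithLp.toLp 2 y))
    (fun i k y => 𝓕⁻ (coordDerivSymbol g i k) (WithLp.toLp 2 y))
    ((continuous_fourierInv_of_integrable hgi).measurable.comp hmp.measurable)
    (fun i k => (hcont i k).measurable.comp hmp.measurable)
    (fun i => by rw [hzero i]) (hasDerivAt_fourierInv_coordDerivSymbol hg hΛ)
  rw [hpull fun x => ‖𝓕⁻ g x‖ₑ ^ 2, hpullE fun x => ‖𝓕⁻ g x‖ₑ ^ 2] at h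
  set I := ∫⁻ x, ‖𝓕⁻ g x‖ₑ ^ 2 with hI
  -- `I` is finite, so the error term can be absorbed.
  have hItop : I ≠ ⊤ := by
    rw [hI, lintegral_enorm_sq_eq_eLpNorm_sq, eLpNorm_fourierInv_eq hgi hg]
    exact ENNReal.pow_ne_top hg.2.ne
  have hsum : ∑ i : Fin d, ∫⁻ y : Fin d → ℝ,
      ‖𝓕⁻ (coordDerivSymbol g i (n + 1)) (WithLp.toLp 2 y)‖ₑ ^ 2
      ≤ ENNReal.ofReal (d * (Λ ^ (n + 1)) ^ 2) * I := by
    calc _ ≤ ∑ _i : Fin d, ENNReal.ofReal ((Λ ^ (n + 1)) ^ 2) * I := by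
          refine Finset.sum_le_sum fun i _ => ?_
          rw [hpull fun x => ‖𝓕⁻ (coordDerivSymbol g i (n + 1)) x‖ₑ ^ 2]
          exact lintegral_fourierInv_coordDerivSymbol_le hg hΛ0 hΛ i (n + 1)
      _ = _ := by
          rw [Finset.sum_const, Finset.card_univ, Fintype.card_fin, nsmul_eq_mul, ← mul_assoc,
            ENNReal.ofReal_mul (Nat.cast_nonneg d), ENNReal.ofReal_natCast]
  set J := ∫⁻ x in Ω', ‖𝓕⁻ g x‖ₑ ^ 2
  have habs : I ≤ ENNReal.ofReal (A ^ (n + 1)) * J + I / 2 := by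
    calc I ≤ ENNReal.ofReal (A ^ (n + 1)) * (J + ENNReal.ofReal (1 / (n.factorial : ℝ) ^ 2) *
          (ENNReal.ofReal (d * (Λ ^ (n + 1)) ^ 2) * I)) := h.trans (by gcongr)
      _ = ENNReal.ofReal (A ^ (n + 1)) * J + ENNReal.ofReal (A ^ (n + 1) *
          (1 / (n.factorial : ℝ) ^ 2 * (d * (Λ ^ (n + 1)) ^ 2))) * I := by
          rw [ENNReal.ofReal_mul (p := A ^ (n + 1)) (by positivity),
            ENNReal.ofReal_mul (p := 1 / (n.factorial : ℝ) ^ 2) (by positivity)]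
          ring
      _ ≤ ENNReal.ofReal (A ^ (n + 1)) * J + ENNReal.ofReal (1 / 2) * I := by gcongr
      _ = _ := by
          rw [one_div, ENNReal.ofReal_inv_of_pos two_pos, ENNReal.ofReal_ofNat, mul_comm _ I,
            ENNReal.div_eq_inv_mul, mul_comm I]
  have hhalf : I / 2 ≤ ENNReal.ofReal (A ^ (n + 1)) * J := by
    have h1 : I / 2 + I / 2 ≤ ENNReal.ofReal (A ^ (n + 1)) * J + I / 2 := by
      rwa [ENNReal.add_halves]
    exact (ENNReal.add_le_add_iff_right (ENNReal.div_ne_top hItop two_ne_zero)).1 h1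
  calc I = 2 * (I / 2) := (ENNReal.mul_div_cancel two_ne_zero ENNReal.ofNat_ne_top).symm
    _ ≤ 2 * (ENNReal.ofReal (A ^ (n + 1)) * J) := by gcongr
    _ = ENNReal.ofReal (2 * A ^ (n + 1)) * J := by
        rw [ENNReal.ofReal_mul two_pos.le, ENNReal.ofReal_ofNat, mul_assoc]
    _ ≤ _ := mul_le_mul' (ENNReal.ofReal_le_ofReal hnB) (lintegral_mono_set hΩ'sub)

end Euclidean

/-! ### Spectral localization -/

section Spectral

open FourierTransform

variable {d : ℕ}

theorem toTemperedDistribution_injective {f g : Lp ℂ 2 (volume : Measure (EuclideanSpace ℝ (Fin d)))}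
    (h : (f : 𝓢'(EuclideanSpace ℝ (Fin d), ℂ)) = g) : f = g := by
  have h1 : f - g ∈ (Lp.toTemperedDistributionCLM ℂ
      (volume : Measure (EuclideanSpace ℝ (Fin d))) 2).ker := by
    rw [LinearMap.mem_ker, ContinuousLinearMap.coe_coe, map_sub,
      Lp.toTemperedDistributionCLM_apply, Lp.toTemperedDistributionCLM_apply, h, sub_self]
  rw [Lp.ker_toTemperedDistributionCLM_eq_bot] at h1
  exact sub_eq_zero.1 ((Submodule.mem_bot ℂ).1 h1)

theorem eLpNorm_le_l2Norm {h : Lp ℂ 2 (volume : Measure (EuclideanSpace ℝ (Fin d)))}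
    {u : 𝓢'(EuclideanSpace ℝ (Fin d), ℂ)} (hu : (h : 𝓢'(EuclideanSpace ℝ (Fin d), ℂ)) = u) :
    eLpNorm h 2 volume ≤ l2Norm u := by
  refine le_iInf₂ fun g hg => ?_
  rw [toTemperedDistribution_injective (hg.trans hu.symm)]

/-- Multiplication of an `L^2` function by a symbol `σ` in the sense of distributions is pointwise
multiplication, also when `σ` is unbounded, as long as the product is again in `L^2`. -/
theorem ae_eq_mul_of_eq_smulLeftCLM {σ : EuclideanSpace ℝ (Fin d) → ℂ} (hσ : σ.HasTemperateGrowth)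
    {W G : Lp ℂ 2 (volume : Measure (EuclideanSpace ℝ (Fin d)))}
    (h : (W : 𝓢'(EuclideanSpace ℝ (Fin d), ℂ)) =
      TemperedDistribution.smulLeftCLM ℂ σ (G : 𝓢'(EuclideanSpace ℝ (Fin d), ℂ))) :
    ∀ᵐ ξ, W ξ = σ ξ * G ξ := by
  have hσc : Continuous σ := hσ.1.continuous
  have hG := (Lp.memLp G).locallyIntegrable (by norm_num)
  refine ae_eq_of_integral_contDiff_smul_eq ((Lp.memLp W).locallyIntegrable (by norm_num))
    (hG.continuous_mul hσc) fun φ hφ hφc => ?_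
  have hc : HasCompactSupport (Complex.ofRealCLM ∘ φ) := hφc.comp_left rfl
  set Φ : 𝓢(EuclideanSpace ℝ (Fin d), ℂ) := hc.toSchwartzMap (by fun_prop)
  have h1 := DFunLike.congr_fun h Φ
  rw [TemperedDistribution.smulLeftCLM_apply_apply, Lp.toTemperedDistribution_apply,
    Lp.toTemperedDistribution_apply] at h1
  refine Eq.trans (b := ∫ ξ, Φ ξ • W ξ) rfl (h1.trans (integral_congr_ae
    (Filter.Eventually.of_forall fun ξ => ?_)))
  simp only [SchwartzMap.smulLeftCLM_apply_apply hσ, smul_eq_mul]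
  change σ ξ * (φ ξ : ℂ) * G ξ = φ ξ • (σ ξ * G ξ)
  rw [Complex.real_smul]
  ring

theorem fourier_ae_eq_fracSymbol_sub_mul {s lam : ℝ}
    {f h : Lp ℂ 2 (volume : Measure (EuclideanSpace ℝ (Fin d)))}
    (hfh : (h : 𝓢'(EuclideanSpace ℝ (Fin d), ℂ)) =
      fracLaplacian d s (f : 𝓢'(EuclideanSpace ℝ (Fin d), ℂ)) -
        (lam : ℂ) • (f : 𝓢'(EuclideanSpace ℝ (Fin d), ℂ))) :
    ∀ᵐ ξ, (𝓕 h : Lp ℂ 2 (volume : Measure (EuclideanSpace ℝ (Fin d)))) ξ =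
      (fracSymbol d s ξ - lam) *
        (𝓕 f : Lp ℂ 2 (volume : Measure (EuclideanSpace ℝ (Fin d)))) ξ := by
  have h1 : ((𝓕 (h + (lam : ℂ) • f) : Lp ℂ 2 (volume : Measure (EuclideanSpace ℝ (Fin d)))) :
      𝓢'(EuclideanSpace ℝ (Fin d), ℂ)) = TemperedDistribution.smulLeftCLM ℂ (fracSymbol d s)
      ((𝓕 f : Lp ℂ 2 (volume : Measure (EuclideanSpace ℝ (Fin d)))) :
        𝓢'(EuclideanSpace ℝ (Fin d), ℂ)) := by
    rw [← Lp.fourier_toTemperedDistribution_eq, ← Lp.fourier_toTemperedDistribution_eq]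
    have h2 : ((h + (lam : ℂ) • f : Lp ℂ 2 (volume : Measure (EuclideanSpace ℝ (Fin d)))) :
        𝓢'(EuclideanSpace ℝ (Fin d), ℂ)) =
        fracLaplacian d s (f : 𝓢'(EuclideanSpace ℝ (Fin d), ℂ)) := by
      have h3 := map_add (Lp.toTemperedDistributionCLM ℂ
        (volume : Measure (EuclideanSpace ℝ (Fin d))) 2) h ((lam : ℂ) • f)
      rw [map_smul] at h3
      simp only [Lp.toTemperedDistributionCLM_apply] at h3
      rw [h3, hfh, sub_add_cancel]
    rw [h2, fracLaplacian, TemperedDistribution.fourierMultiplierCLM_apply,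
      FourierTransform.fourier_fourierInv_eq]
  have h4 : (𝓕 (h + (lam : ℂ) • f) : Lp ℂ 2 (volume : Measure (EuclideanSpace ℝ (Fin d))))
      = 𝓕 h + (lam : ℂ) • 𝓕 f := by
    rw [FourierTransform.fourier_add, FourierTransform.fourier_smul]
  rw [h4] at h1
  filter_upwards [ae_eq_mul_of_eq_smulLeftCLM (hasTemperateGrowth_fracSymbol d s) h1,
    Lp.coeFn_add (𝓕 h) ((lam : ℂ) • 𝓕 f), Lp.coeFn_smul (lam : ℂ) (𝓕 f)] with ξ e1 e2 e3
  rw [e2, Pi.add_apply, e3, Pi.smul_apply, smul_eq_mul] at e1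
  rw [sub_mul, ← e1, add_sub_cancel_right]

theorem le_one_add_sq_rpow {s : ℝ} (hs : 1 ≤ s) (r : ℝ) :
    r ≤ (1 + r ^ 2) ^ (s / 2) := calc
  r ≤ Real.sqrt (1 + r ^ 2) := Real.le_sqrt_of_sq_le (by linarith)
  _ = (1 + r ^ 2) ^ (1 / 2 : ℝ) := Real.sqrt_eq_rpow _
  _ ≤ (1 + r ^ 2) ^ (s / 2) :=
    Real.rpow_le_rpow_of_exponent_le (by nlinarith [sq_nonneg r]) (by linarith)

theorem ennreal_add_sq_le_two_mul (a b : ℝ≥0∞) : (a + b) ^ 2 ≤ 2 * a ^ 2 + 2 * b ^ 2 := by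
  rcases eq_or_ne a ⊤ with rfl | ha
  · simp
  rcases eq_or_ne b ⊤ with rfl | hb
  · simp
  lift a to NNReal using ha
  lift b to NNReal using hb
  rw [← mul_add]
  exact_mod_cast add_sq_le (a := a) (b := b)

/-- The part of `f` at the frequencies where the symbol is at most `lam + 1` is band-limited, and
the remaining part is bounded by `h = ((-Δ + 1)^(s/2) - lam) f`, as the symbol minus `lam` is at
least `1` there. -/
theorem exists_band_limited_approximation {s : ℝ} (hs : 1 ≤ s) {lam : ℝ}
    {f h : Lp ℂ 2 (volume : Measure (EuclideanSpace ℝ (Fin d)))}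
    (hfh : (h : 𝓢'(EuclideanSpace ℝ (Fin d), ℂ)) =
      fracLaplacian d s (f : 𝓢'(EuclideanSpace ℝ (Fin d), ℂ)) -
        (lam : ℂ) • (f : 𝓢'(EuclideanSpace ℝ (Fin d), ℂ))) :
    ∃ g : EuclideanSpace ℝ (Fin d) → ℂ, MemLp g 2 ∧
      (∀ ξ, g ξ ≠ 0 → ‖(2 * Real.pi) • ξ‖ ≤ lam + 1) ∧ AEStronglyMeasurable (𝓕⁻ g) ∧
      eLpNorm (fun x => f x - 𝓕⁻ g x) 2 volume ≤ eLpNorm h 2 volume := by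
  set p : EuclideanSpace ℝ (Fin d) → ℝ := fun ξ => (1 + ‖(2 * Real.pi) • ξ‖ ^ 2) ^ (s / 2)
  have hp : Continuous p := by
    refine Continuous.rpow_const (by fun_prop) fun ξ => Or.inl ?_
    positivity
  set S : Set (EuclideanSpace ℝ (Fin d)) := {ξ | p ξ ≤ lam + 1}
  have hS : MeasurableSet S := measurableSet_le hp.measurable measurable_const
  set G : Lp ℂ 2 (volume : Measure (EuclideanSpace ℝ (Fin d))) := 𝓕 f with hG
  set g : EuclideanSpace ℝ (Fin d) → ℂ := S.indicator G
  have hg : MemLp g 2 := (Lp.memLp G).indicator hS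
  have hsupp : ∀ ξ, g ξ ≠ 0 → ‖(2 * Real.pi) • ξ‖ ≤ lam + 1 := by
    intro ξ hξ
    have hξS : ξ ∈ S := Set.mem_of_indicator_ne_zero hξ
    exact (le_one_add_sq_rpow hs _).trans hξS
  have hgi := (integrable_and_integrable_norm_mul_of_memLp hg hsupp).1
  refine ⟨g, hg, hsupp, (continuous_fourierInv_of_integrable hgi).aestronglyMeasurable, ?_⟩
  have hsub : f - 𝓕⁻ (hg.toLp g) = 𝓕⁻ (G - hg.toLp g) := by
    have h1 : 𝓕⁻ (G - hg.toLp g) = 𝓕⁻ G - 𝓕⁻ (hg.toLp g) :=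
      (Lp.fourierTransformₗᵢ (EuclideanSpace ℝ (Fin d)) ℂ).symm.map_sub _ _
    rw [h1, hG, FourierTransform.fourierInv_fourier_eq]
  have hle : ‖f - 𝓕⁻ (hg.toLp g)‖ ≤ ‖h‖ := by
    rw [hsub, ← Lp.norm_fourier_eq h, ← Lp.norm_fourier_eq (𝓕⁻ (G - hg.toLp g)),
      FourierTransform.fourier_fourierInv_eq]
    refine Lp.norm_le_norm_of_ae_le ?_
    filter_upwards [fourier_ae_eq_fracSymbol_sub_mul hfh, Lp.coeFn_sub G (hg.toLp g),
      hg.coeFn_toLp] with ξ e1 e2 e3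
    rw [e1, e2, Pi.sub_apply, e3]
    by_cases hξ : ξ ∈ S
    · simp only [g, Set.indicator_of_mem hξ, sub_self, norm_zero]
      positivity
    · simp only [g, Set.indicator_of_notMem hξ, sub_zero]
      have h1 : lam + 1 < p ξ := not_le.1 hξ
      have h2 : fracSymbol d s ξ - lam = ((p ξ - lam : ℝ) : ℂ) := by
        rw [Complex.ofReal_sub]
        rfl
      rw [norm_mul, h2, Complex.norm_real, Real.norm_of_nonneg (by linarith)]
      exact le_mul_of_one_le_left (norm_nonneg _) (by linarith)
  have hae : (fun x => f x - 𝓕⁻ g x) =ᵐ[volume] (f - 𝓕⁻ (hg.toLp g) :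
      Lp ℂ 2 (volume : Measure (EuclideanSpace ℝ (Fin d)))) := by
    filter_upwards [Lp.coeFn_sub f (𝓕⁻ (hg.toLp g)), fourierInv_toLp_ae_eq hgi hg] with x e1 e2
    rw [e1, Pi.sub_apply, e2]
  rw [eLpNorm_congr_ae hae, ← Lp.enorm_def, ← Lp.enorm_def]
  exact enorm_le_iff_norm_le.2 hle

end Spectral

theorem mainTheorem2 (d : ℕ) (s : ℝ) (hs : 1 ≤ s) (Ω : Set (EuclideanSpace ℝ (Fin d)))
    (hΩ : IsThick Ω) :
    ∃ C c : ℝ, 0 < C ∧ 0 < c ∧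
      ∀ (f : Lp ℂ 2 (volume : Measure (EuclideanSpace ℝ (Fin d)))) (lam : ℝ), 0 ≤ lam →
        ENNReal.ofReal (c * Real.exp (-C * lam)) * eLpNorm f 2 volume ^ 2 ≤
          l2Norm (fracLaplacian d s (f : 𝓢'(EuclideanSpace ℝ (Fin d), ℂ)) -
              (lam : ℂ) • (f : 𝓢'(EuclideanSpace ℝ (Fin d), ℂ))) ^ 2 +
            eLpNorm f 2 (volume.restrict Ω) ^ 2 := by
  obtain ⟨B, hB, hLS⟩ := hΩ.lintegral_fourierInv_le
  -- The frequency bound is `lam + 1`, so the constant is `exp (B * (lam + 2))` up to a factor `6`,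
  -- which comes from the two applications of `(a + b) ^ 2 ≤ 2 * a ^ 2 + 2 * b ^ 2`.
  refine ⟨B, Real.exp (-(2 * B)) / 6, hB, by positivity, fun f lam hlam => ?_⟩
  set u := fracLaplacian d s (f : 𝓢'(EuclideanSpace ℝ (Fin d), ℂ)) -
    (lam : ℂ) • (f : 𝓢'(EuclideanSpace ℝ (Fin d), ℂ)) with hu
  by_cases hex : ∃ h : Lp ℂ 2 (volume : Measure (EuclideanSpace ℝ (Fin d))),
      (h : 𝓢'(EuclideanSpace ℝ (Fin d), ℂ)) = u
  swap
  -- If `u` is not in `L^2`, its norm is infinite.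
  · have htop : l2Norm u = ⊤ := by
      refine iInf₂_eq_top.2 fun g hg => absurd ⟨g, hg⟩ hex
    simp [htop]
  obtain ⟨h, hh⟩ := hex
  obtain ⟨g, hg, hsupp, hgm, happrox⟩ := exists_band_limited_approximation hs (hh.trans hu)
  set w := FourierTransformInv.fourierInv g
  have hQ : eLpNorm (fun x => f x - w x) 2 volume ≤ l2Norm u :=
    happrox.trans (eLpNorm_le_l2Norm hh)
  have hfm : AEStronglyMeasurable f volume := Lp.aestronglyMeasurable f
  set X := ENNReal.ofReal (Real.exp (B * (lam + 1 + 1)))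
  have hX1 : 1 ≤ X := ENNReal.one_le_ofReal.2 (Real.one_le_exp (by positivity))
  have hP : eLpNorm w 2 volume ^ 2 ≤ X * eLpNorm w 2 (volume.restrict Ω) ^ 2 := by
    rw [← lintegral_enorm_sq_eq_eLpNorm_sq, ← lintegral_enorm_sq_eq_eLpNorm_sq]
    exact hLS (lam + 1) (by linarith) g hg hsupp
  have hN : eLpNorm f 2 volume ≤ eLpNorm w 2 volume + l2Norm u := by
    have h1 := eLpNorm_add_le hgm (hfm.sub hgm) (p := 2) (by norm_num)
    rw [add_sub_cancel] at h1
    exact h1.trans (by gcongr; exact hQ)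
  have hPΩ : eLpNorm w 2 (volume.restrict Ω) ≤ eLpNorm f 2 (volume.restrict Ω) + l2Norm u := by
    have h1 := eLpNorm_sub_le (hfm.restrict (s := Ω)) ((hfm.sub hgm).restrict (s := Ω)) (p := 2)
      (by norm_num)
    rw [sub_sub_cancel] at h1
    refine h1.trans ?_
    gcongr
    exact (eLpNorm_mono_measure _ Measure.restrict_le_self).trans hQ
  have hmain : eLpNorm f 2 volume ^ 2
      ≤ 6 * X * (l2Norm u ^ 2 + eLpNorm f 2 (volume.restrict Ω) ^ 2) := by
    set D := l2Norm u
    set NΩ := eLpNorm f 2 (volume.restrict Ω)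
    calc eLpNorm f 2 volume ^ 2 ≤ (eLpNorm w 2 volume + D) ^ 2 := by gcongr
      _ ≤ 2 * eLpNorm w 2 volume ^ 2 + 2 * D ^ 2 := ennreal_add_sq_le_two_mul _ _
      _ ≤ 2 * (X * (NΩ + D) ^ 2) + 2 * (X * D ^ 2) := by
          gcongr
          · exact hP.trans (by gcongr)
          · exact le_mul_of_one_le_left' hX1
      _ ≤ 2 * (X * (2 * NΩ ^ 2 + 2 * D ^ 2)) + 2 * (X * D ^ 2) := by
          gcongr
          exact ennreal_add_sq_le_two_mul _ _
      _ = 6 * X * D ^ 2 + 4 * X * NΩ ^ 2 := by ring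
      _ ≤ 6 * X * D ^ 2 + 6 * X * NΩ ^ 2 := by
          gcongr
          norm_num
      _ = _ := by ring
  calc ENNReal.ofReal (Real.exp (-(2 * B)) / 6 * Real.exp (-B * lam)) * eLpNorm f 2 volume ^ 2
      ≤ ENNReal.ofReal (Real.exp (-(2 * B)) / 6 * Real.exp (-B * lam)) *
          (6 * X * (l2Norm u ^ 2 + eLpNorm f 2 (volume.restrict Ω) ^ 2)) := by gcongr
    _ = ENNReal.ofReal (Real.exp (-(2 * B)) / 6 * Real.exp (-B * lam) *
          (6 * Real.exp (B * (lam + 1 + 1)))) *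
          (l2Norm u ^ 2 + eLpNorm f 2 (volume.restrict Ω) ^ 2) := by
        rw [ENNReal.ofReal_mul (q := 6 * Real.exp (B * (lam + 1 + 1))) (by positivity),
          ENNReal.ofReal_mul (p := 6) (by norm_num), ENNReal.ofReal_ofNat]
        ring
    _ = _ := by
        have h1 : Real.exp (-(2 * B)) / 6 * Real.exp (-B * lam) *
            (6 * Real.exp (B * (lam + 1 + 1))) = 1 := by
          rw [show ∀ a b c : ℝ, a / 6 * b * (6 * c) = a * b * c by intros; ring, ← Real.exp_add,
            ← Real.exp_add, show -(2 * B) + -B * lam + B * (lam + 1 + 1) = 0 by ring,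
            Real.exp_zero]
        rw [h1, ENNReal.ofReal_one, one_mul]
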